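/- **Setting.** Let $d\ge 1$, $k\ge 2$, $L\ge 1$, $n\ge 1$, and let $\phi:\mathbb R\to\mathbb R$ be positive homogeneous ($\phi(\alpha z)=\alpha\phi(z)$ for $\alpha>0$), $1$-Lipschitz, with $\phi(0)=0$. An $L$-layer network is $f(x)=f(x;W)=W_L\phi(W_{L-1}\phi(\cdots\phi(W_1x)))$, where $W_\ell\in\mathbb R^{d_\ell\times d_{\ell-1}}$, $d_0=d$, $d_L=k$, the hidden widths $d_1,\dots,d_{L-1}$ are arbitrary, and $\phi$ acts entrywise. Put $\prod_1^L|W_\ell|=|W_L|\cdots|W_1|\in\mathbb R^{k\times d}$, with entrywise absolute values. For $v\in\mathbb R^k$ and $y\in\{1,\dots,k\}$ let $\mathcal M(v,y)=v_y-\max_{j\ne y}v_j$. Let $\mathcal D$ be a probability distribution on $\mathbb R^d\times\{1,\dots,k\}$ and let $S=((x^1,y^1),\dots,(x^n,y^n))$ be i.i.d. from $\mathcal D$. Put $\ell(f)=\mathbb P_{(x,y)\sim\mathcal D}(\mathcal M(f(x),y)\le 0)$ and, for $\gamma>0$, $\hat\ell_\gamma(f)=\frac1n\#\{i:\mathcal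 M(f(x^i),y^i)\le\gamma\}$. Let $1\le q\le 2$ and $\frac1q+\frac1{q^*}=1$. For $A\in\mathbb R^{k\times d}$ let $\|A\|_{q^*}=\sup_{z\ne0}\|Az\|_{q^*}/\|z\|_{q^*}$ and let $\|A\|_{q,1}=\sum_{i=1}^k\big(\sum_{j=1}^d|a_{ij}|^q\big)^{1/q}$, the sum over output units of the $\ell_q$ norms of the rows. For $1\le j\le d$ let $w^{(q)}_j=\big(\frac1n\sum_{i=1}^n|x^i_j|^{q^*}\big)^{1/q^*}$ if $q>1$ and $w^{(1)}_j=\max_i|x^i_j|$. The $q$-path distribution is the probability distribution on paths $(j_0,\dots,j_L)$, $1\le j_\ell\le d_\ell$, proportional to $w^{(q)}_{j_0}\prod_{\ell=1}^L|W_\ell[j_\ell,j_{\ell-1}]|$ (read as the zero vector if all these weights vanish). Let $p^{(q)}_\ell$ be its marginal on $j_\ell$, and let $$\zeta_q=\frac1L\Big(1+\sum_{\ell=1}^{L-1}e^{\frac12H_{1/2}(p^{(q)}_\ell)}\Big),\qquad H_{1/2}(p)=2\log\sum_j\sqrt{p_j}$$ (the Rényi entropy of order $1/2$, with the convention $\log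 0=0$ for the zero vector). **Statement.** There is a universal constant $C>0$ such that for all $d,k,L,n,\phi,q,\mathcal D$ as above and every $\delta\in(0,1)$, with probability at least $1-\delta$ over $S$ (that is, the exceptional set of samples has outer measure at most $\delta$), simultaneously for all hidden widths, all weights $W$ and all $\gamma>0$, both $$\ell(f)-\hat\ell_\gamma(f)\le C(1+\log n)\left(\frac{\max_i\|x^i\|_{q^*}\,\big\|\prod_1^L|W_\ell|\big\|_{q,1}\,\zeta_q\,L\sqrt{L+\log d}}{\gamma\sqrt n}+\sqrt{\frac{\log(1/\delta)}n}\right)$$ and $$\ell(f)-\hat\ell_\gamma(f)\le C(1+\log n)\left(\frac{\max_i\|x^i\|_{q^*}\,k^{1-1/q^*}\,\big\|\prod_1^L|W_\ell|\big\|_{q^*}\,\zeta_q\,L\sqrt{L+\log d}}{\gamma\sqrt n}+\sqrt{\frac{\log(1/\delta)}n}\right).$$ -/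

import Mathlib

open MeasureTheory
open scoped ENNReal Matrix

noncomputable section

namespace PathNorm

/-- The `ℓ_p` norm of a real vector, `1 ≤ p ≤ ∞`. -/
def vecNorm {ι : Type*} [Fintype ι] (p : ℝ≥0∞) (v : ι → ℝ) : ℝ :=
  ‖WithLp.toLp p v‖

/-- The matrix norm induced by the `ℓ_p` vector norms, `sup_z ‖A z‖_p / ‖z‖_p`.
The vector `z = 0` only contributes the value `0 / 0 = 0`. -/
def inducedNorm {ι κ : Type*} [Fintype ι] [Fintype κ] (p : ℝ≥0∞) (A : Matrix ι κ ℝ) : ℝ :=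
  ⨆ z : κ → ℝ, vecNorm p (A *ᵥ z) / vecNorm p z

/-- The `(p, 1)` norm of a matrix of a network (rows indexed by output units, columns by
input units): the sum over the output units of the `ℓ_p` norms of their weight vectors. -/
def mixedNorm {ι κ : Type*} [Fintype ι] [Fintype κ] (p : ℝ≥0∞) (A : Matrix ι κ ℝ) : ℝ :=
  ∑ i, vecNorm p (A i)

/-- Rényi entropy of order `α` of a probability vector `p`. -/
def renyiEntropy {ι : Type*} [Fintype ι] (α : ℝ) (p : ι → ℝ) : ℝ :=
  (1 - α)⁻¹ * Real.log (∑ i, p i ^ α)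

/-- An activation function that is positive homogeneous, 1-Lipschitz, and vanishes at `0`. -/
structure IsActivation (φ : ℝ → ℝ) : Prop where
  posHom : ∀ a : ℝ, 0 < a → ∀ z : ℝ, φ (a * z) = a * φ z
  lipschitz : LipschitzWith 1 φ
  map_zero : φ 0 = 0

/-- The weights of an `L`-layer network with `d` inputs, `k` outputs and arbitrary hidden widths.
The matrix `W ℓ` (`ℓ = 0, …, L - 1`) maps layer `ℓ` to layer `ℓ + 1`; layer `0` is the
input layer and layer `L` is the output layer. -/
structure Net (d k L : ℕ) where
  width : Fin (L + 1) → ℕ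
  width_zero : width 0 = d
  width_last : width (Fin.last L) = k
  W : ∀ ℓ : Fin L, Matrix (Fin (width ℓ.succ)) (Fin (width ℓ.castSucc)) ℝ

namespace Net

variable {d k L : ℕ}

/-- The inputs `z_ℓ` of the units of layer `ℓ`: `z_0 = x`, `z_1 = W_1 x` and
`z_{ℓ+1} = W_{ℓ+1} φ(z_ℓ)` for `ℓ ≥ 1`. -/
def preact (N : Net d k L) (φ : ℝ → ℝ) (x : Fin d → ℝ) :
    ∀ ℓ : Fin (L + 1), Fin (N.width ℓ) → ℝ :=
  Fin.induction
    (fun j => x (Fin.cast N.width_zero j))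
    (fun ℓ z => N.W ℓ *ᵥ (if ℓ.val = 0 then z else fun i => φ (z i)))

/-- The network function `f(x; W) = W_L φ(W_{L-1} φ(⋯ φ(W_1 x)))`. -/
def eval (N : Net d k L) (φ : ℝ → ℝ) (x : Fin d → ℝ) : Fin k → ℝ :=
  fun c => N.preact φ x (Fin.last L) (Fin.cast N.width_last.symm c)

/-- The partial products `|W_ℓ| ⋯ |W_1|` (the identity for `ℓ = 0`). -/
def partialAbsProd (N : Net d k L) : ∀ ℓ : Fin (L + 1), Matrix (Fin (N.width ℓ)) (Fin d) ℝ :=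
  Fin.induction
    (Matrix.of fun i j => if Fin.cast N.width_zero i = j then 1 else 0)
    (fun ℓ P => (N.W ℓ).map (fun w => |w|) * P)

/-- The `k × d` matrix `|W_L| ⋯ |W_1|`, with entrywise absolute values. -/
def absProd (N : Net d k L) : Matrix (Fin k) (Fin d) ℝ :=
  Matrix.of fun c j => N.partialAbsProd (Fin.last L) (Fin.cast N.width_last.symm c) j

/-- A path `(j_0, …, j_L)` chooses one unit in each layer. -/
abbrev Path (N : Net d k L) : Type := ∀ ℓ : Fin (L + 1), Fin (N.width ℓ)

/-- The weight `w_{j_0, …, j_L} = ∏_ℓ |W_ℓ[j_ℓ, j_{ℓ-1}]|` of a path. -/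
def pathWeight (N : Net d k L) (j : N.Path) : ℝ :=
  ∏ ℓ : Fin L, |N.W ℓ (j ℓ.succ) (j ℓ.castSucc)|

end Net

/-- The input weights `w^{(q)}_{j_0}` of a data set `X = (x^1, …, x^n)`. -/
def inputWeight {d n : ℕ} (q : ℝ≥0∞) (X : Fin n → Fin d → ℝ) (j : Fin d) : ℝ :=
  if q = 1 then ⨆ i, |X i j|
  else ((∑ i, |X i j| ^ q.conjExponent.toReal) / n) ^ (1 / q.conjExponent.toReal)

namespace Net

variable {d k L n : ℕ}

/-- The unnormalized `q`-path weight `w^{(q)}_{j_0} w_{j_0, …, j_L}`. -/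
def dataPathWeight (N : Net d k L) (q : ℝ≥0∞) (X : Fin n → Fin d → ℝ) (j : N.Path) : ℝ :=
  inputWeight q X (Fin.cast N.width_zero (j 0)) * N.pathWeight j

/-- The `q`-path variation. -/
def pathVariation (N : Net d k L) (q : ℝ≥0∞) (X : Fin n → Fin d → ℝ) : ℝ :=
  ∑ j : N.Path, N.dataPathWeight q X j

/-- The `q`-path distribution (the zero vector if the `q`-path variation vanishes). -/
def pathDist (N : Net d k L) (q : ℝ≥0∞) (X : Fin n → Fin d → ℝ) (j : N.Path) : ℝ :=
  N.dataPathWeight q X j / N.pathVariation q X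

/-- The marginal of the `q`-path distribution on layer `ℓ`. -/
def pathMarginal (N : Net d k L) (q : ℝ≥0∞) (X : Fin n → Fin d → ℝ) (ℓ : Fin (L + 1))
    (i : Fin (N.width ℓ)) : ℝ :=
  ∑ j : N.Path, if j ℓ = i then N.pathDist q X j else 0

/-- The `q`-path complexity
`ζ_q = (1 / L) (1 + ∑_{ℓ = 1}^{L - 1} exp (H_{1/2}(p_ℓ^{(q)}) / 2))`;
the sum runs over the hidden layers. -/
def pathComplexity (N : Net d k L) (q : ℝ≥0∞) (X : Fin n → Fin d → ℝ) : ℝ :=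
  (1 / (L : ℝ)) * (1 + ∑ ℓ : Fin (L + 1),
    if ℓ ≠ 0 ∧ ℓ ≠ Fin.last L then
      Real.exp ((1 / 2) * renyiEntropy (1 / 2) (N.pathMarginal q X ℓ)) else 0)

end Net

/-- The margin operator `v_y - max_{j ≠ y} v_j` (for at least two classes). -/
def margin {k : ℕ} (v : Fin k → ℝ) (y : Fin k) : ℝ :=
  v y - ⨆ j : {j : Fin k // j ≠ y}, v j

/-- The `γ`-margin loss of a score function `f`; `γ = 0` is the classification loss. -/
def marginLoss {d k : ℕ} (γ : ℝ) (f : (Fin d → ℝ) → Fin k → ℝ) (z : (Fin d → ℝ) × Fin k) : ℝ :=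
  if margin (f z.1) z.2 ≤ γ then 1 else 0

/-- The population classification loss `ℓ(f)`. -/
def popLoss {d k : ℕ} (D : Measure ((Fin d → ℝ) × Fin k)) (f : (Fin d → ℝ) → Fin k → ℝ) : ℝ :=
  ∫ z, marginLoss 0 f z ∂D

/-- The empirical `γ`-margin loss on a labelled sample. -/
def empLoss {d k n : ℕ} (γ : ℝ) (S : Fin n → (Fin d → ℝ) × Fin k)
    (f : (Fin d → ℝ) → Fin k → ℝ) : ℝ :=
  (1 / (n : ℝ)) * ∑ i, marginLoss γ f (S i)

/-- The inputs `x^1, …, x^n` of a labelled sample. -/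
def inputs {d k n : ℕ} (S : Fin n → (Fin d → ℝ) × Fin k) : Fin n → Fin d → ℝ :=
  fun i => (S i).1

/-- `max_{x ∈ S} ‖x‖_p`. -/
def maxNorm {d n : ℕ} (p : ℝ≥0∞) (X : Fin n → Fin d → ℝ) : ℝ :=
  ⨆ i, vecNorm p (X i)

/-- The expression inside `Õ(·)`, for a given value `B` of the norm of the weights:
`max_{x ∈ S} ‖x‖_{q*} B ζ_q L √(L + log d) / (γ √n) + √(log (1 / δ) / n)`. -/
def rate {d k L n : ℕ} (q : ℝ≥0∞) (δ γ : ℝ) (X : Fin n → Fin d → ℝ) (N : Net d k L) (B : ℝ) : ℝ :=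
  maxNorm q.conjExponent X * B * N.pathComplexity q X * L * Real.sqrt (L + Real.log d)
      / (γ * Real.sqrt n)
    + Real.sqrt (Real.log (1 / δ) / n)

end PathNorm

end

noncomputable section

namespace PathNorm

open scoped BigOperators

/-! ### Averages over the sign hypercube -/

/-! The path complexity only enlarges the right-hand side. Each hidden layer contributes at least
`1` to `L * ζ_q` (`one_le_pathComplexity`), so `ζ_q * L ≥ 1`, and it suffices to prove the bound
without this factor. Both matrix norms enter only through Hölder's inequality: each provides a
number `B` such that the row sums of `|W_L| ⋯ |W_1| |x|` add up to at most `B * ‖x‖_{q*}`. The core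
statement `measure_not_generalization_le` allows any such `B`.

Width independence comes from normalization. Divide each unit by the total weight of the paths
ending at it, with inputs weighted by their root mean squares on the data. By positive homogeneity a
normalized unit is an absolutely convex combination of activated normalized units of the layer
below. Contraction and convexity thus bound the exponential moment of the supremum over all units of
all networks by twice that of the layer below (`expect_exp_layerFamily_le`). After `L` layers the
constant is `2 ^ L * 2 * (d + 1)`, whose logarithm is of order `L + log d`.

The number of classes disappears because the scores, divided by the margin, have absolute sum at
most `b`: at each data point at most `n` of them exceed `b / n`. Up to an additive error, margins
therefore see at most `n + n ^ 2 + 1` output slots (`exists_output_slots`). A vector contraction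
gives each slot its own signs, and a maximum over the slots costs only `log n`.

Symmetrization and a Chernoff bound turn these Rademacher estimates into uniform deviation bounds
for ramp losses. They are proved for finite families and pass to all networks by density, continuity
and continuity of measure from below. Unbounded inputs are truncated at a quantile `r` of the input
norm, which with high probability the sample maximum reaches. A union bound over dyadic scales `b =
2 ^ s` makes the result uniform in weights and margin; if the sample maximum times `B` is at most
`γ`, the empirical loss is already `1`. -/

/-- The sign `±1` of a Boolean. -/
def sgn (b : Bool) : ℝ := if b then 1 else -1

lemma sgn_true : sgn true = 1 := rfl

lemma sgn_false : sgn false = -1 := rfl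

lemma sgn_not (b : Bool) : sgn (!b) = -sgn b := by cases b <;> simp [sgn]

lemma abs_sgn (b : Bool) : |sgn b| = 1 := by cases b <;> simp [sgn]

lemma expect_bool (F : Bool → ℝ) : 𝔼 b, F b = (F true + F false) / 2 := by
  rw [Fintype.expect_eq_sum_div_card]; simp

lemma expect_le_expect' {α : Type*} [Fintype α] {F G : α → ℝ} (h : ∀ a, F a ≤ G a) :
    𝔼 a, F a ≤ 𝔼 a, G a :=
  Finset.expect_le_expect fun a _ => h a

lemma expect_cons {n : ℕ} {α : Type*} [Fintype α] (F : (Fin (n + 1) → α) → ℝ) :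
    𝔼 σ, F σ = 𝔼 a, 𝔼 τ : Fin n → α, F (Fin.cons a τ) := by
  rw [← Finset.expect_product', Finset.univ_product_univ]
  exact (Fintype.expect_equiv (Fin.consEquiv fun _ => α) _ _ fun _ => rfl).symm

/-- Replacing the random summands of a functional one coordinate at a time. -/
lemma expect_sum_le_expect_sum {n : ℕ} {α β E : Type*} [Fintype α] [Fintype β] [AddCommMonoid E]
    (Ψ : E → ℝ) (p : Fin n → α → E) (q : Fin n → β → E)
    (h : ∀ i A, 𝔼 a, Ψ (A + p i a) ≤ 𝔼 b, Ψ (A + q i b)) (A : E) :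
    𝔼 σ : Fin n → α, Ψ (A + ∑ i, p i (σ i)) ≤ 𝔼 τ : Fin n → β, Ψ (A + ∑ i, q i (τ i)) := by
  induction n generalizing A with
  | zero => simp
  | succ n ih =>
    rw [expect_cons, expect_cons]
    simp only [Fin.sum_univ_succ, Fin.cons_zero, Fin.cons_succ]
    calc 𝔼 a, 𝔼 σ : Fin n → α, Ψ (A + (p 0 a + ∑ i, p i.succ (σ i)))
        ≤ 𝔼 a, 𝔼 τ : Fin n → β, Ψ (A + (p 0 a + ∑ i, q i.succ (τ i))) := by
          refine expect_le_expect' fun a => ?_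
          simp only [← add_assoc]
          exact ih (fun i => p i.succ) (fun i => q i.succ) (fun i => h i.succ) (A + p 0 a)
      _ = 𝔼 τ : Fin n → β, 𝔼 a, Ψ (A + ∑ i, q i.succ (τ i) + p 0 a) := by
          rw [Finset.expect_comm]
          simp only [add_comm, add_left_comm]
      _ ≤ 𝔼 τ : Fin n → β, 𝔼 b, Ψ (A + ∑ i, q i.succ (τ i) + q 0 b) :=
          expect_le_expect' fun τ => h 0 _
      _ = 𝔼 b, 𝔼 τ : Fin n → β, Ψ (A + (q 0 b + ∑ i, q i.succ (τ i))) := by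
          rw [Finset.expect_comm]
          simp only [add_comm, add_left_comm]

lemma expect_neg_sign {n : ℕ} (F : (Fin n → ℝ) → ℝ) :
    𝔼 σ : Fin n → Bool, F (fun i => -sgn (σ i)) = 𝔼 σ : Fin n → Bool, F (fun i => sgn (σ i)) :=
  Fintype.expect_equiv (Equiv.piCongrRight fun _ => Equiv.boolNot) _ _ fun σ => by
    congr 1; funext i; simp [sgn_not]

/-- The hypotheses say that `(x, y)` is weakly majorized by `(u, v)`, and `exp` is convex and
increasing. -/
lemma exp_add_exp_le {x y u v : ℝ} (hs : x + y ≤ u + v) (hx : x ≤ max u v) (hy : y ≤ max u v) :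
    Real.exp x + Real.exp y ≤ Real.exp u + Real.exp v := by
  wlog huv : v ≤ u generalizing u v
  · rw [add_comm (Real.exp u)]
    exact this (by linarith) (by rwa [max_comm]) (by rwa [max_comm]) (le_of_not_ge huv)
  wlog hxy : y ≤ x generalizing x y
  · rw [add_comm (Real.exp x)]
    exact this (by linarith) hy hx (le_of_not_ge hxy)
  rw [max_eq_left huv] at hx
  rcases le_total x v with hxv | hxv
  · exact add_le_add (Real.exp_le_exp.2 hx) (Real.exp_le_exp.2 (hxy.trans hxv))
  · have h1 : Real.exp y ≤ Real.exp (v - x) * Real.exp u := by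
      rw [← Real.exp_add]; exact Real.exp_le_exp.2 (by linarith)
    have h2 : Real.exp v = Real.exp (v - x) * Real.exp x := by rw [← Real.exp_add]; congr 1; ring
    have h3 : Real.exp (v - x) ≤ 1 := Real.exp_le_one_iff.2 (by linarith)
    have h4 : Real.exp x ≤ Real.exp u := Real.exp_le_exp.2 hx
    rw [h2]
    nlinarith [mul_nonneg (sub_nonneg.2 h3) (sub_nonneg.2 h4)]

section sup

variable {ι : Type*} [Finite ι]

lemma le_iSup_of_finite (f : ι → ℝ) (i : ι) : f i ≤ ⨆ i, f i :=
  le_ciSup (Set.finite_range f).bddAbove i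

lemma exp_iSup_le_sum [Fintype ι] [Nonempty ι] (f : ι → ℝ) :
    Real.exp (⨆ i, f i) ≤ ∑ i, Real.exp (f i) := by
  obtain ⟨i, hi⟩ := exists_eq_ciSup_of_finite (f := f)
  rw [← hi]
  exact Finset.single_le_sum (f := fun i => Real.exp (f i)) (fun _ _ => (Real.exp_pos _).le)
    (Finset.mem_univ i)

/-- One step of the contraction principle for exponential moments. -/
lemma expect_exp_iSup_contraction [Nonempty ι] {l : ℝ} (hl : 0 ≤ l) (A s t : ι → ℝ)
    (h : ∀ i j, |s i - s j| ≤ |t i - t j|) (h0 : ∀ i, |s i| ≤ |t i|) :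
    𝔼 b, Real.exp (l * ⨆ i, (A + fun i => sgn b * s i) i)
      ≤ 𝔼 b, Real.exp (l * ⨆ i, (A + fun i => sgn b * t i) i) := by
  rw [expect_bool, expect_bool]
  simp only [sgn_true, sgn_false, Pi.add_apply, one_mul, neg_mul]
  obtain ⟨i, hi⟩ := exists_eq_ciSup_of_finite (f := fun i => A i + s i)
  obtain ⟨j, hj⟩ := exists_eq_ciSup_of_finite (f := fun i => A i + -s i)
  rw [← hi, ← hj]
  set U := ⨆ i, A i + t i with hU
  set V := ⨆ i, A i + -t i with hV
  have hUi : ∀ i, A i + t i ≤ U := fun i => le_iSup_of_finite (fun i => A i + t i) i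
  have hVi : ∀ i, A i + -t i ≤ V := fun i => le_iSup_of_finite (fun i => A i + -t i) i
  have key : ∀ i, ∀ c, c ≤ |t i| → A i + c ≤ max U V := by
    intro i c hc
    rcases abs_cases (t i) with ⟨h1, _⟩ | ⟨h1, _⟩
    · exact le_max_of_le_left (by linarith [hUi i])
    · exact le_max_of_le_right (by linarith [hVi i])
  have hmax : l * max U V = max (l * U) (l * V) := mul_max_of_nonneg _ _ hl
  -- The bound on the sum of exponents uses the contraction of differences; the bounds on each
  -- exponent separately use `|s| ≤ |t|`, which for an activation comes from `φ 0 = 0`.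
  refine div_le_div_of_nonneg_right (exp_add_exp_le ?_ ?_ ?_) (by norm_num)
  · rw [← mul_add, ← mul_add]
    refine mul_le_mul_of_nonneg_left ?_ hl
    have h1 := (le_abs_self _).trans (h i j)
    rcases abs_cases (t i - t j) with ⟨h2, _⟩ | ⟨h2, _⟩
    · linarith [hUi i, hVi j]
    · linarith [hUi j, hVi i]
  · rw [← hmax]
    exact mul_le_mul_of_nonneg_left (key i _ ((le_abs_self _).trans (h0 i))) hl
  · rw [← hmax]
    exact mul_le_mul_of_nonneg_left (key j _ ((neg_le_abs _).trans (h0 j))) hl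

/-- The contraction principle for exponential moments. -/
lemma expect_exp_iSup_comp_le [Nonempty ι] {n : ℕ} {l : ℝ} (hl : 0 ≤ l) {φ : ℝ → ℝ}
    (hφ : LipschitzWith 1 φ) (hφ0 : φ 0 = 0) (t : ι → Fin n → ℝ) :
    𝔼 σ : Fin n → Bool, Real.exp (l * ⨆ a, ∑ i, sgn (σ i) * φ (t a i))
      ≤ 𝔼 σ : Fin n → Bool, Real.exp (l * ⨆ a, ∑ i, sgn (σ i) * t a i) := by
  have hd : ∀ x y, |φ x - φ y| ≤ |x - y| := fun x y => by
    simpa [Real.dist_eq] using hφ.dist_le_mul x y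
  have := expect_sum_le_expect_sum (fun A : ι → ℝ => Real.exp (l * ⨆ a, A a))
    (fun (i : Fin n) b => fun a => sgn b * φ (t a i)) (fun i b => fun a => sgn b * t a i)
    (fun i A => expect_exp_iSup_contraction hl A _ _ (fun a b => hd _ _)
      (fun a => by simpa [hφ0] using hd (t a i) 0)) 0
  simpa [Finset.sum_apply] using this

/-- Exponential moments of a Rademacher process do not see the absolute value, up to a
factor `2`. -/
lemma expect_exp_iSup_abs_le [Nonempty ι] {n : ℕ} {l : ℝ} (hl : 0 ≤ l) (t : ι → Fin n → ℝ) :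
    𝔼 σ : Fin n → Bool, Real.exp (l * ⨆ a, |∑ i, sgn (σ i) * t a i|)
      ≤ 2 * 𝔼 σ : Fin n → Bool, Real.exp (l * ⨆ a, ∑ i, sgn (σ i) * t a i) := by
  have hneg := expect_neg_sign (n := n) fun σ => Real.exp (l * ⨆ a, ∑ i, σ i * t a i)
  rw [two_mul]
  nth_rewrite 1 [← hneg]
  rw [← Finset.expect_add_distrib]
  refine expect_le_expect' fun σ => ?_
  obtain ⟨a, ha⟩ := exists_eq_ciSup_of_finite (f := fun a => |∑ i, sgn (σ i) * t a i|)
  rw [← ha]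
  rcases abs_cases (∑ i, sgn (σ i) * t a i) with ⟨h1, _⟩ | ⟨h1, _⟩
  · refine le_add_of_nonneg_of_le (Real.exp_pos _).le (Real.exp_le_exp.2 ?_)
    rw [h1]
    exact mul_le_mul_of_nonneg_left (le_iSup_of_finite (fun a => ∑ i, sgn (σ i) * t a i) a) hl
  · refine le_add_of_le_of_nonneg (Real.exp_le_exp.2 ?_) (Real.exp_pos _).le
    rw [h1]
    refine mul_le_mul_of_nonneg_left (le_trans (le_of_eq ?_)
      (le_iSup_of_finite (fun a => ∑ i, -sgn (σ i) * t a i) a)) hl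
    simp

/-- Hoeffding's bound from `cosh t ≤ exp (t ^ 2 / 2)`. The replacement principle is applied with
deterministic new summands, that is, random variables on `Unit`. -/
lemma expect_exp_sum_le {n : ℕ} (t : Fin n → ℝ) :
    𝔼 σ : Fin n → Bool, Real.exp (∑ i, sgn (σ i) * t i) ≤ Real.exp ((∑ i, t i ^ 2) / 2) := by
  have h : ∀ i, ∀ A : ℝ, 𝔼 b, Real.exp (A + sgn b * t i)
      ≤ 𝔼 _b : Unit, Real.exp (A + t i ^ 2 / 2) := by
    intro i A
    rw [expect_bool, Fintype.expect_const, Real.exp_add A]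
    have h1 := Real.cosh_le_exp_half_sq (t i)
    rw [Real.cosh_eq] at h1
    simp only [sgn, Real.exp_add, if_true, Bool.false_eq_true, if_false, one_mul, neg_mul]
    have := mul_le_mul_of_nonneg_left h1 (Real.exp_pos A).le
    linarith
  have := expect_sum_le_expect_sum (fun x : ℝ => Real.exp x)
    (fun (i : Fin n) b => sgn b * t i) (fun i (_ : Unit) => t i ^ 2 / 2) h 0
  simpa [← Finset.sum_div] using this

/-- Exponential moments of the supremum of finitely many Rademacher sums. -/
lemma expect_exp_iSup_abs_le_card [Fintype ι] [Nonempty ι] {n : ℕ} {l v : ℝ} (hl : 0 ≤ l)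
    (t : ι → Fin n → ℝ) (ht : ∀ a, ∑ i, t a i ^ 2 ≤ v) :
    𝔼 σ : Fin n → Bool, Real.exp (l * ⨆ a, |∑ i, sgn (σ i) * t a i|)
      ≤ 2 * Fintype.card ι * Real.exp (l ^ 2 * v / 2) := by
  refine (expect_exp_iSup_abs_le hl t).trans ?_
  rw [mul_assoc]
  refine mul_le_mul_of_nonneg_left ?_ zero_le_two
  calc 𝔼 σ : Fin n → Bool, Real.exp (l * ⨆ a, ∑ i, sgn (σ i) * t a i)
      ≤ 𝔼 σ : Fin n → Bool, ∑ a, Real.exp (∑ i, sgn (σ i) * (l * t a i)) := by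
        refine expect_le_expect' fun σ => ?_
        rw [Real.mul_iSup_of_nonneg hl]
        refine (exp_iSup_le_sum _).trans (le_of_eq ?_)
        simp only [Finset.mul_sum, mul_left_comm]
    _ = ∑ a, 𝔼 σ : Fin n → Bool, Real.exp (∑ i, sgn (σ i) * (l * t a i)) :=
        Finset.expect_sum_comm _ _ _
    _ ≤ ∑ _a : ι, Real.exp (l ^ 2 * v / 2) := by
        refine Finset.sum_le_sum fun a _ => (expect_exp_sum_le _).trans (Real.exp_le_exp.2 ?_)
        simp only [mul_pow, ← Finset.mul_sum]
        have := mul_le_mul_of_nonneg_left (ht a) (sq_nonneg l)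
        linarith
    _ = _ := by simp

/-- Passing from a family of functions to absolutely convex combinations of the composed family
at most doubles the exponential moment. -/
lemma expect_exp_iSup_abs_convex_le {κ : Type*} [Nonempty ι] [Finite κ] [Nonempty κ]
    {n : ℕ} {l : ℝ} (hl : 0 ≤ l) {φ : ℝ → ℝ} (hφ : LipschitzWith 1 φ) (hφ0 : φ 0 = 0)
    (t : ι → Fin n → ℝ) (s : κ → Fin n → ℝ)
    (h : ∀ b, ∃ (m : ℕ) (c : Fin m → ℝ) (e : Fin m → ι), ∑ j, |c j| ≤ 1 ∧
      ∀ i, s b i = ∑ j, c j * φ (t (e j) i)) :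
    𝔼 σ : Fin n → Bool, Real.exp (l * ⨆ b, |∑ i, sgn (σ i) * s b i|)
      ≤ 2 * 𝔼 σ : Fin n → Bool, Real.exp (l * ⨆ a, |∑ i, sgn (σ i) * t a i|) := by
  calc 𝔼 σ : Fin n → Bool, Real.exp (l * ⨆ b, |∑ i, sgn (σ i) * s b i|)
      ≤ 𝔼 σ : Fin n → Bool, Real.exp (l * ⨆ a, |∑ i, sgn (σ i) * φ (t a i)|) := by
        refine expect_le_expect' fun σ => Real.exp_le_exp.2 (mul_le_mul_of_nonneg_left ?_ hl)
        refine ciSup_le fun b => ?_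
        obtain ⟨m, c, e, hc, hs⟩ := h b
        set M := ⨆ a, |∑ i, sgn (σ i) * φ (t a i)| with hM
        have hMa : ∀ a, |∑ i, sgn (σ i) * φ (t a i)| ≤ M :=
          fun a => le_iSup_of_finite (fun a => |∑ i, sgn (σ i) * φ (t a i)|) a
        have hM0 : 0 ≤ M := (abs_nonneg _).trans (hMa (Classical.arbitrary ι))
        have : ∑ i, sgn (σ i) * s b i = ∑ j, c j * ∑ i, sgn (σ i) * φ (t (e j) i) := by
          simp only [hs, Finset.mul_sum]
          rw [Finset.sum_comm]
          simp only [mul_left_comm]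
        rw [this]
        calc |∑ j, c j * ∑ i, sgn (σ i) * φ (t (e j) i)|
            ≤ ∑ j, |c j| * M := by
              refine (Finset.abs_sum_le_sum_abs _ _).trans (Finset.sum_le_sum fun j _ => ?_)
              rw [abs_mul]
              exact mul_le_mul_of_nonneg_left (hMa (e j)) (abs_nonneg _)
          _ ≤ M := by
              rw [← Finset.sum_mul]
              exact mul_le_of_le_one_left hM0 hc
    -- The contraction principle has no absolute values, so they are removed first; this is the only
    -- source of the factor `2`.
    _ ≤ 2 * 𝔼 σ : Fin n → Bool, Real.exp (l * ⨆ a, ∑ i, sgn (σ i) * φ (t a i)) :=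
        expect_exp_iSup_abs_le hl _
    _ ≤ 2 * 𝔼 σ : Fin n → Bool, Real.exp (l * ⨆ a, ∑ i, sgn (σ i) * t a i) :=
        mul_le_mul_of_nonneg_left (expect_exp_iSup_comp_le hl hφ hφ0 t) zero_le_two
    _ ≤ _ := by
        refine mul_le_mul_of_nonneg_left (expect_le_expect' fun σ => Real.exp_le_exp.2
          (mul_le_mul_of_nonneg_left ?_ hl)) zero_le_two
        exact ciSup_mono (Set.finite_range _).bddAbove fun a => le_abs_self _

/-- Flipping the sign at `s` preserves the average and moves the sum by `2 * |c s|`, so the absolute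
values before and after the flip add up to at least that. -/
lemma abs_le_expect_abs_sum {κ : Type*} [Fintype κ] [DecidableEq κ] (c : κ → ℝ) (s : κ) :
    |c s| ≤ 𝔼 τ : κ → Bool, |∑ r, sgn (τ r) * c r| := by
  have hflip : 𝔼 τ : κ → Bool, |∑ r, sgn (τ r) * c r|
      = 𝔼 τ : κ → Bool, |∑ r, sgn (Function.update τ s (!τ s) r) * c r| := by
    refine Fintype.expect_equiv
      (Function.Involutive.toPerm (fun τ : κ → Bool => Function.update τ s (!τ s)) ?_) _ _ ?_
    · intro τ; ext r; by_cases hr : r = s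
      · subst hr; simp
      · simp [hr]
    · intro τ
      congr 1
      refine Finset.sum_congr rfl fun r _ => ?_
      by_cases hr : r = s
      · subst hr; simp [Function.Involutive.toPerm]
      · simp [hr, Function.Involutive.toPerm]
  have h2 : ∀ τ : κ → Bool, 2 * |c s| ≤ |∑ r, sgn (τ r) * c r|
      + |∑ r, sgn (Function.update τ s (!τ s) r) * c r| := by
    intro τ
    have e1 : ∑ r, sgn (τ r) * c r - ∑ r, sgn (Function.update τ s (!τ s) r) * c r
        = 2 * (sgn (τ s) * c s) := by
      rw [← Finset.sum_sub_distrib, Finset.sum_eq_single s]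
      · simp [sgn_not]; ring
      · intro r _ hr; simp [hr]
      · simp
    calc 2 * |c s| = |2 * (sgn (τ s) * c s)| := by simp [abs_mul, abs_sgn]
      _ ≤ _ := by rw [← e1]; exact abs_sub _ _
  have h3 := expect_le_expect' h2
  rw [Finset.expect_add_distrib, ← hflip, Fintype.expect_const] at h3
  linarith

/-- One step of the vector contraction principle, for functions that are Lipschitz with respect
to the maximum norm up to an additive error. -/
lemma expect_iSup_vector_contraction [Nonempty ι] {κ : Type*} [Fintype κ] [DecidableEq κ]
    (A g : ι → ℝ) (h : ι → κ → ℝ) (η : ℝ)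
    (hg : ∀ a b, ∃ s, g a - g b ≤ |h a s - h b s| + η) :
    𝔼 b, (⨆ a, (A + fun a => sgn b * g a) a)
      ≤ 𝔼 τ : κ → Bool, (⨆ a, (A + fun a => ∑ s, sgn (τ s) * h a s + η / 2) a) := by
  rw [expect_bool]
  simp only [sgn_true, sgn_false, Pi.add_apply, one_mul, neg_mul]
  obtain ⟨i, hi⟩ := exists_eq_ciSup_of_finite (f := fun i => A i + g i)
  obtain ⟨j, hj⟩ := exists_eq_ciSup_of_finite (f := fun i => A i + -g i)
  rw [← hi, ← hj]
  obtain ⟨s, hs⟩ := hg i j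
  set F : (κ → Bool) → ℝ := fun τ => ⨆ a, A a + (∑ s, sgn (τ s) * h a s + η / 2) with hF
  have hFa : ∀ τ a, A a + (∑ s, sgn (τ s) * h a s + η / 2) ≤ F τ :=
    fun τ a => le_iSup_of_finite (fun a => A a + (∑ s, sgn (τ s) * h a s + η / 2)) a
  have hneg : (𝔼 τ : κ → Bool, F (fun s => !τ s)) = 𝔼 τ, F τ :=
    Fintype.expect_equiv (Equiv.piCongrRight fun _ => Equiv.boolNot) _ _ fun σ => rfl
  have h1 := abs_le_expect_abs_sum (fun s => h i s - h j s) s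
  -- Test the two suprema at `i` and `j`, in whichever order makes the difference of the sums
  -- positive; each supremum contributes `η / 2`.
  have h2 : ∀ τ : κ → Bool, A i + A j + |∑ r, sgn (τ r) * (h i r - h j r)| + η
      ≤ F τ + F (fun s => !τ s) := by
    intro τ
    simp only [mul_sub, Finset.sum_sub_distrib]
    have e1 := hFa τ i
    have e2 := hFa τ j
    have e3 := hFa (fun s => !τ s) i
    have e4 := hFa (fun s => !τ s) j
    simp only [sgn_not, neg_mul, Finset.sum_neg_distrib] at e3 e4
    rcases abs_cases (∑ s, sgn (τ s) * h i s - ∑ s, sgn (τ s) * h j s) with ⟨h2, _⟩ | ⟨h2, _⟩ <;>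
      rw [h2] <;> linarith
  have h3 := expect_le_expect' h2
  rw [Finset.expect_add_distrib, Finset.expect_add_distrib, Finset.expect_add_distrib,
    Finset.expect_add_distrib, hneg, Fintype.expect_const, Fintype.expect_const,
    Fintype.expect_const] at h3
  change _ ≤ 𝔼 τ, F τ
  linarith

/-- The vector contraction principle. -/
lemma expect_iSup_le_vector [Nonempty ι] {κ : Type*} [Fintype κ]
    [DecidableEq κ] {n : ℕ}
    (g : ι → Fin n → ℝ) (h : ι → Fin n → κ → ℝ) (η : ℝ)
    (hg : ∀ i a b, ∃ s, g a i - g b i ≤ |h a i s - h b i s| + η) :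
    𝔼 σ : Fin n → Bool, (⨆ a, ∑ i, sgn (σ i) * g a i)
      ≤ 𝔼 τ : Fin n → κ → Bool, (⨆ a, ∑ i, ∑ s, sgn (τ i s) * h a i s) + n * η / 2 := by
  have := expect_sum_le_expect_sum (fun A : ι → ℝ => ⨆ a, A a)
    (fun (i : Fin n) b => fun a => sgn b * g a i)
    (fun i (τ : κ → Bool) => fun a => ∑ s, sgn (τ s) * h a i s + η / 2)
    (fun i A => expect_iSup_vector_contraction A _ _ η (hg i)) 0
  simp only [zero_add, Finset.sum_apply] at this
  refine this.trans (le_of_eq ?_)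
  rw [← Fintype.expect_const (ι := Fin n → κ → Bool) ((n : ℝ) * η / 2),
    ← Finset.expect_add_distrib]
  refine Finset.expect_congr rfl fun τ _ => ?_
  simp only [Finset.sum_add_distrib, Finset.sum_const, Finset.card_univ, Fintype.card_fin,
    nsmul_eq_mul]
  rw [ciSup_add (Set.finite_range _).bddAbove, mul_div_assoc]

end sup

/-- Bounded differences on the hypercube: exponential moments around the mean. -/
lemma expect_exp_le_of_bounded_diff {n : ℕ} (l : ℝ) (H : (Fin n → Bool) → ℝ)
    (h : ∀ σ i b, |H σ - H (Function.update σ i b)| ≤ 2) :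
    𝔼 σ, Real.exp (l * H σ) ≤ Real.exp (l * (𝔼 σ, H σ) + l ^ 2 * n / 2) := by
  induction n with
  | zero => simp
  | succ n ih =>
    rw [expect_cons, expect_cons, expect_bool, expect_bool]
    have h' : ∀ c : Bool, ∀ σ : Fin n → Bool, ∀ i b,
        |H (Fin.cons c σ) - H (Fin.cons c (Function.update σ i b))| ≤ 2 := by
      intro c σ i b
      rw [Fin.cons_update]
      exact h _ _ _
    have i1 := ih (fun σ => H (Fin.cons true σ)) (h' true)
    have i2 := ih (fun σ => H (Fin.cons false σ)) (h' false)
    set p := 𝔼 σ : Fin n → Bool, H (Fin.cons true σ) with hp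
    set m := 𝔼 σ : Fin n → Bool, H (Fin.cons false σ) with hm
    have hpm : |p - m| ≤ 2 := by
      rw [hp, hm, ← Finset.expect_sub_distrib]
      refine (Finset.abs_expect_le _ _).trans ?_
      rw [← Fintype.expect_const (ι := Fin n → Bool) (2 : ℝ)]
      refine expect_le_expect' fun σ => ?_
      have := h (Fin.cons true σ) 0 false
      rwa [Fin.update_cons_zero] at this
    -- The conditional means given the first sign are `(p + m) / 2 ± (p - m) / 2`, so this sign
    -- contributes the factor `cosh (l * (p - m) / 2) ≤ exp (l ^ 2 / 2)`.
    have hc := Real.cosh_le_exp_half_sq (l * (p - m) / 2)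
    rw [Real.cosh_eq] at hc
    have hsq : (p - m) ^ 2 ≤ 4 := by nlinarith [sq_abs (p - m), abs_nonneg (p - m)]
    calc _ ≤ (Real.exp (l * p + l ^ 2 * n / 2) + Real.exp (l * m + l ^ 2 * n / 2)) / 2 := by
          linarith
      _ = Real.exp (l * ((p + m) / 2) + l ^ 2 * n / 2) *
          ((Real.exp (l * (p - m) / 2) + Real.exp (-(l * (p - m) / 2))) / 2) := by
          rw [mul_div_assoc', mul_add, ← Real.exp_add, ← Real.exp_add]
          congr 3 <;> ring
      _ ≤ Real.exp (l * ((p + m) / 2) + l ^ 2 * n / 2) * Real.exp (l ^ 2 / 2) := by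
          refine mul_le_mul_of_nonneg_left (hc.trans (Real.exp_le_exp.2 ?_)) (Real.exp_pos _).le
          nlinarith [mul_le_mul_of_nonneg_left hsq (sq_nonneg l)]
      _ = _ := by
          rw [← Real.exp_add]
          congr 1
          push_cast
          ring

/-! ### Symmetrization -/

section symmetrization

variable {Z : Type*} [MeasurableSpace Z] {n : ℕ}

/-- Exchange the entries of the two samples at the places where `σ` is `false`. -/
def swapSamples (σ : Fin n → Bool) (p : (Fin n → Z) × (Fin n → Z)) : (Fin n → Z) × (Fin n → Z) :=
  (fun i => if σ i then p.1 i else p.2 i, fun i => if σ i then p.2 i else p.1 i)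

lemma measurePreserving_swapSamples (D : Measure Z) [IsProbabilityMeasure D] (σ : Fin n → Bool) :
    MeasurePreserving (swapSamples σ)
      ((Measure.pi fun _ : Fin n => D).prod (Measure.pi fun _ : Fin n => D))
      ((Measure.pi fun _ : Fin n => D).prod (Measure.pi fun _ : Fin n => D)) := by
  have he := measurePreserving_arrowProdEquivProdArrow Z Z (Fin n) (fun _ => D) (fun _ => D)
  have hp : MeasurePreserving
      (fun (ω : Fin n → Z × Z) i => (if σ i then id else Prod.swap : Z × Z → Z × Z) (ω i))
      (Measure.pi fun _ => D.prod D) (Measure.pi fun _ => D.prod D) := by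
    refine measurePreserving_pi _ _ fun i => ?_
    by_cases h : σ i
    · simp only [h, if_true]; exact MeasurePreserving.id _
    · simp only [h]; exact Measure.measurePreserving_swap
  have := he.comp (hp.comp he.symm)
  convert this using 1
  funext p
  refine Prod.ext ?_ ?_ <;> funext i <;> by_cases h : σ i <;>
    simp [swapSamples, h, MeasurableEquiv.arrowProdEquivProdArrow, Equiv.arrowProdEquivProdArrow]

lemma measurable_exp_iSup_sum {ι : Type*} [Finite ι] {Y : Type*} [MeasurableSpace Y] (l : ℝ) {g : ι → Y → ℝ}
    (hg : ∀ a, Measurable (g a)) : Measurable fun y => Real.exp (l * ⨆ a, g a y) :=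
  Real.measurable_exp.comp ((Measurable.iSup hg).const_mul l)

lemma exp_iSup_le_of_le {ι : Type*} [Nonempty ι] {l M : ℝ} (hl : 0 ≤ l) {g : ι → ℝ} (hg : ∀ a, g a ≤ M) :
    Real.exp (l * ⨆ a, g a) ≤ Real.exp (l * M) :=
  Real.exp_le_exp.2 (mul_le_mul_of_nonneg_left (ciSup_le hg) hl)

variable {ι : Type*} [Finite ι] [Nonempty ι]

lemma integrable_exp_iSup {Y : Type*} [MeasurableSpace Y] {μ : Measure Y} [IsFiniteMeasure μ]
    {l M : ℝ} (hl : 0 ≤ l) {g : ι → Y → ℝ} (hg : ∀ a, Measurable (g a)) (hM : ∀ a y, g a y ≤ M) :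
    Integrable (fun y => Real.exp (l * ⨆ a, g a y)) μ := by
  refine Integrable.of_bound (measurable_exp_iSup_sum l hg).aestronglyMeasurable
    (Real.exp (l * M)) (ae_of_all _ fun y => ?_)
  rw [Real.norm_eq_abs, abs_of_pos (Real.exp_pos _)]
  exact exp_iSup_le_of_le hl fun a => hM a y

/-- The exponential moment of the uniform deviation of the empirical means, for a finite class of
functions with values in `[0, 1]` whose Rademacher sums are at most `ρ`. -/
lemma integral_exp_uniform_deviation_le (D : Measure Z) [IsProbabilityMeasure D] (f : ι → Z → ℝ)
    (hf : ∀ a, Measurable (f a)) (hf0 : ∀ a z, 0 ≤ f a z) (hf1 : ∀ a z, f a z ≤ 1) {ρ : ℝ}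
    (hρ : ∀ z : Fin n → Z, 𝔼 σ : Fin n → Bool, (⨆ a, ∑ i, sgn (σ i) * f a (z i)) ≤ ρ)
    {l : ℝ} (hl : 0 ≤ l) :
    ∫ S : Fin n → Z, Real.exp (l * ⨆ a, ∑ i, (∫ z, f a z ∂D - f a (S i)))
        ∂(Measure.pi fun _ => D)
      ≤ Real.exp (2 * l * ρ + l ^ 2 * n / 2) := by
  set P : Measure (Fin n → Z) := Measure.pi fun _ => D with hP
  have hfi : ∀ a, Integrable (f a) D := fun a => Integrable.of_bound (hf a).aestronglyMeasurable 1
    (ae_of_all _ fun z => by rw [Real.norm_eq_abs, abs_of_nonneg (hf0 a z)]; exact hf1 a z)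
  have hfS : ∀ a i, Measurable fun S : Fin n → Z => f a (S i) :=
    fun a i => (hf a).comp (measurable_pi_apply i)
  have hfSi : ∀ a i, Integrable (fun S : Fin n → Z => f a (S i)) P :=
    fun a i => (measurePreserving_eval (fun _ : Fin n => D) i).integrable_comp_of_integrable (hfi a)
  have hfSint : ∀ a i, ∫ S : Fin n → Z, f a (S i) ∂P = ∫ z, f a z ∂D := fun a i => by
    rw [← (measurePreserving_eval (fun _ : Fin n => D) i).map_eq, integral_map
      (measurePreserving_eval (fun _ : Fin n => D) i).measurable.aemeasurable
      (hf a).aestronglyMeasurable]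
  have hsum : ∀ c : Fin n → ℝ, (∀ i, c i ≤ 1) → ∑ i, c i ≤ n := fun c hc => by
    simpa using Finset.sum_le_sum fun i (_ : i ∈ Finset.univ) => hc i
  have hf01 : ∀ a z z', f a z' - f a z ≤ 1 := fun a z z' => by linarith [hf0 a z, hf1 a z']
  set Φ : (Fin n → Z) × (Fin n → Z) → ℝ :=
    fun p => Real.exp (l * ⨆ a, ∑ i, (f a (p.2 i) - f a (p.1 i))) with hΦ
  have hmeas : ∀ (σ : Fin n → Bool) a, Measurable fun p : (Fin n → Z) × (Fin n → Z) =>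
      ∑ i, sgn (σ i) * (f a (p.2 i) - f a (p.1 i)) := fun σ a =>
    Finset.measurable_sum _ fun i _ => (((hfS a i).comp measurable_snd).sub
      ((hfS a i).comp measurable_fst)).const_mul _
  have hΦi : Integrable Φ (P.prod P) := by
    have := integrable_exp_iSup (μ := P.prod P) (M := n) hl (hmeas fun _ => true) fun a p =>
      hsum _ fun i => by simpa [sgn] using hf01 a (p.1 i) (p.2 i)
    simpa only [sgn_true, one_mul] using this
  -- Ghost sample: Jensen's inequality is applied to the maximizing index alone, and then the
  -- supremum is restored inside the integral.
  have hA : ∀ S : Fin n → Z, Real.exp (l * ⨆ a, ∑ i, (∫ z, f a z ∂D - f a (S i)))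
      ≤ ∫ S' : Fin n → Z, Φ (S, S') ∂P := by
    intro S
    have hm : ∀ a, Measurable fun S' : Fin n → Z => ∑ i, (f a (S' i) - f a (S i)) := fun a =>
      Finset.measurable_sum _ fun i _ => (hfS a i).sub_const _
    obtain ⟨a, ha⟩ := exists_eq_ciSup_of_finite
      (f := fun a => ∑ i, (∫ z, f a z ∂D - f a (S i)))
    rw [← ha]
    have hb := integrable_exp_iSup (ι := Unit) (μ := P) (M := n) hl (fun _ => hm a)
      fun _ S' => hsum _ fun i => hf01 a (S i) (S' i)
    simp only [ciSup_const] at hb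
    have hg : Integrable (fun S' : Fin n → Z => l * ∑ i, (f a (S' i) - f a (S i))) P :=
      (integrable_finsetSum _ fun i _ => (hfSi a i).sub (integrable_const _)).const_mul _
    have hj := convexOn_exp.map_integral_le (μ := P)
      (f := fun S' : Fin n → Z => l * ∑ i, (f a (S' i) - f a (S i)))
      Real.continuous_exp.continuousOn isClosed_univ (ae_of_all _ fun _ => Set.mem_univ _) hg hb
    refine le_trans (le_of_eq ?_) (hj.trans (integral_mono hb
      (integrable_exp_iSup (M := n) hl hm fun a S' => hsum _ fun i => hf01 a (S i) (S' i)) ?_))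
    · congr 1
      have hi : ∀ i, ∫ S' : Fin n → Z, (f a (S' i) - f a (S i)) ∂P
          = ∫ z, f a z ∂D - f a (S i) := fun i => by
        rw [integral_sub (hfSi a i) (integrable_const _), hfSint]
        simp
      rw [integral_const_mul, integral_finsetSum (μ := P) Finset.univ
        (f := fun i (S' : Fin n → Z) => f a (S' i) - f a (S i))
        fun i _ => (hfSi a i).sub (integrable_const _)]
      simp only [hi]
    · intro S'
      exact Real.exp_le_exp.2 (mul_le_mul_of_nonneg_left
        (le_iSup_of_finite (fun a => ∑ i, (f a (S' i) - f a (S i))) a) hl)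
  have hswap : ∀ σ : Fin n → Bool, ∫ p, Real.exp (l * ⨆ a, ∑ i, sgn (σ i) *
      (f a (p.2 i) - f a (p.1 i))) ∂(P.prod P) = ∫ p, Φ p ∂(P.prod P) := by
    intro σ
    have hT := measurePreserving_swapSamples D σ
    have hc : ∫ p, Φ (swapSamples σ p) ∂(P.prod P) = ∫ p, Φ p ∂(P.prod P) := by
      have := integral_map (f := Φ) hT.measurable.aemeasurable
        (by rw [hT.map_eq]; exact hΦi.aestronglyMeasurable)
      rwa [hT.map_eq, eq_comm] at this
    rw [← hc]
    refine integral_congr_ae (ae_of_all _ fun p => ?_)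
    simp only [hΦ, swapSamples]
    congr 3
    funext a
    refine Finset.sum_congr rfl fun i _ => ?_
    by_cases h : σ i <;> simp [h, sgn]
  -- For a fixed double sample, the supremum has mean at most `2 * ρ`, and changing one sign alters
  -- it by at most `2`.
  have hC : ∀ p : (Fin n → Z) × (Fin n → Z), 𝔼 σ : Fin n → Bool, Real.exp (l * ⨆ a,
      ∑ i, sgn (σ i) * (f a (p.2 i) - f a (p.1 i))) ≤ Real.exp (2 * l * ρ + l ^ 2 * n / 2) := by
    intro p
    have hH := expect_exp_le_of_bounded_diff l
      (fun σ : Fin n → Bool => ⨆ a, ∑ i, sgn (σ i) * (f a (p.2 i) - f a (p.1 i))) ?_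
    · refine hH.trans (Real.exp_le_exp.2 ?_)
      have h1 : 𝔼 σ : Fin n → Bool, (⨆ a, ∑ i, sgn (σ i) * (f a (p.2 i) - f a (p.1 i)))
          ≤ 2 * ρ := by
        have hneg := expect_neg_sign (n := n) fun σ => ⨆ a, ∑ i, σ i * f a (p.1 i)
        calc _ ≤ 𝔼 σ : Fin n → Bool, ((⨆ a, ∑ i, sgn (σ i) * f a (p.2 i))
              + ⨆ a, ∑ i, -sgn (σ i) * f a (p.1 i)) := by
              refine expect_le_expect' fun σ => ciSup_le fun a => ?_
              have e : ∑ i, sgn (σ i) * (f a (p.2 i) - f a (p.1 i))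
                  = ∑ i, sgn (σ i) * f a (p.2 i) + ∑ i, -sgn (σ i) * f a (p.1 i) := by
                rw [← Finset.sum_add_distrib]
                exact Finset.sum_congr rfl fun i _ => by ring
              rw [e]
              exact add_le_add (le_iSup_of_finite (fun a => ∑ i, sgn (σ i) * f a (p.2 i)) a)
                (le_iSup_of_finite (fun a => ∑ i, -sgn (σ i) * f a (p.1 i)) a)
          _ ≤ 2 * ρ := by
              rw [Finset.expect_add_distrib, hneg]
              linarith [hρ p.1, hρ p.2]
      have := mul_le_mul_of_nonneg_left h1 hl
      linarith
    · have hle : ∀ (σ : Fin n → Bool) i b,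
          (⨆ a, ∑ j, sgn (σ j) * (f a (p.2 j) - f a (p.1 j)))
          ≤ (⨆ a, ∑ j, sgn (Function.update σ i b j) * (f a (p.2 j) - f a (p.1 j))) + 2 := by
        intro σ i b
        refine ciSup_le fun a => ?_
        have e := le_iSup_of_finite
          (fun a => ∑ j, sgn (Function.update σ i b j) * (f a (p.2 j) - f a (p.1 j))) a
        refine le_trans ?_ (add_le_add_left e 2)
        have e2 : ∑ j, sgn (σ j) * (f a (p.2 j) - f a (p.1 j))
            - ∑ j, sgn (Function.update σ i b j) * (f a (p.2 j) - f a (p.1 j))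
            = (sgn (σ i) - sgn b) * (f a (p.2 i) - f a (p.1 i)) := by
          rw [← Finset.sum_sub_distrib, Finset.sum_eq_single i]
          · simp; ring
          · intro r _ hr; simp [hr]
          · simp
        have e3 : (sgn (σ i) - sgn b) * (f a (p.2 i) - f a (p.1 i)) ≤ 2 := by
          have := hf01 a (p.1 i) (p.2 i)
          have := hf01 a (p.2 i) (p.1 i)
          cases σ i <;> cases b <;> simp only [sgn_true, sgn_false] <;> linarith
        linarith
      intro σ i b
      have h1 := hle σ i b
      have h2 := hle (Function.update σ i b) i (σ i)
      rw [Function.update_idem, Function.update_eq_self] at h2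
      exact abs_sub_le_iff.2 ⟨by linarith, by linarith⟩
  have hΦσ : ∀ σ : Fin n → Bool, Integrable (fun p : (Fin n → Z) × (Fin n → Z) =>
      Real.exp (l * ⨆ a, ∑ i, sgn (σ i) * (f a (p.2 i) - f a (p.1 i)))) (P.prod P) := fun σ =>
    integrable_exp_iSup (M := n) hl (hmeas σ) fun a p => hsum _ fun i => by
      have := hf01 a (p.1 i) (p.2 i)
      have := hf01 a (p.2 i) (p.1 i)
      cases σ i <;> simp only [sgn_true, sgn_false] <;> linarith
  calc ∫ S : Fin n → Z, Real.exp (l * ⨆ a, ∑ i, (∫ z, f a z ∂D - f a (S i))) ∂P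
      ≤ ∫ S, ∫ S', Φ (S, S') ∂P ∂P := by
        refine integral_mono (integrable_exp_iSup (M := n) hl
          (fun a => Finset.measurable_sum _ fun i _ => measurable_const.sub (hfS a i)) ?_)
          hΦi.integral_prod_left hA
        intro a S
        refine hsum _ fun i => ?_
        have : ∫ z, f a z ∂D ≤ ∫ _z, (1 : ℝ) ∂D :=
          integral_mono (hfi a) (integrable_const _) (hf1 a)
        simp only [integral_const, probReal_univ, smul_eq_mul, mul_one] at this
        linarith [hf0 a (S i)]
    _ = ∫ p, Φ p ∂(P.prod P) := (integral_prod _ hΦi).symm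
    _ = 𝔼 σ : Fin n → Bool, ∫ p, Real.exp (l * ⨆ a, ∑ i, sgn (σ i) *
          (f a (p.2 i) - f a (p.1 i))) ∂(P.prod P) := by
        rw [Finset.expect_congr rfl fun σ _ => hswap σ, Fintype.expect_const]
    _ = ∫ p, (𝔼 σ : Fin n → Bool, Real.exp (l * ⨆ a, ∑ i, sgn (σ i) *
          (f a (p.2 i) - f a (p.1 i)))) ∂(P.prod P) := by
        simp only [Fintype.expect_eq_sum_div_card]
        rw [integral_div, integral_finsetSum _ fun σ _ => hΦσ σ]
    _ ≤ ∫ _p, Real.exp (2 * l * ρ + l ^ 2 * n / 2) ∂(P.prod P) := by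
        refine integral_mono ?_ (integrable_const _) hC
        simp only [Fintype.expect_eq_sum_div_card]
        exact (integrable_finsetSum _ fun σ _ => hΦσ σ).div_const _
    _ = _ := by simp

/-- Uniform deviation inequality for a finite class of functions with values in `[0, 1]`. -/
lemma measure_uniform_deviation_le (hn : 1 ≤ n) (D : Measure Z) [IsProbabilityMeasure D]
    (f : ι → Z → ℝ) (hf : ∀ a, Measurable (f a)) (hf0 : ∀ a z, 0 ≤ f a z)
    (hf1 : ∀ a z, f a z ≤ 1) {ρ : ℝ}
    (hρ : ∀ z : Fin n → Z, 𝔼 σ : Fin n → Bool, (⨆ a, ∑ i, sgn (σ i) * f a (z i)) ≤ ρ)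
    {u : ℝ} (hu : 0 ≤ u) :
    (Measure.pi fun _ : Fin n => D) {S | ∃ a, 2 * ρ / n + Real.sqrt (2 * u / n)
        < ∫ z, f a z ∂D - (1 / (n : ℝ)) * ∑ i, f a (S i)} ≤ ENNReal.ofReal (Real.exp (-u)) := by
  have hn0 : (0 : ℝ) < n := by exact_mod_cast hn
  -- The optimal Chernoff parameter at the threshold `2 * ρ + n * e` is `e` itself, with final
  -- exponent `-n * e ^ 2 / 2 = -u`.
  set e := Real.sqrt (2 * u / n) with he
  have he0 : 0 ≤ e := Real.sqrt_nonneg _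
  have he2 : e ^ 2 = 2 * u / n := Real.sq_sqrt (by positivity)
  have hint := integral_exp_uniform_deviation_le D f hf hf0 hf1 hρ he0
  have hf01 : ∀ a, ∫ z, f a z ∂D ≤ 1 := fun a => by
    have : ∫ z, f a z ∂D ≤ ∫ _z, (1 : ℝ) ∂D := by
      refine integral_mono_of_nonneg (ae_of_all _ (hf0 a)) (integrable_const _)
        (ae_of_all _ (hf1 a))
    simpa using this
  have hI : Integrable (fun S : Fin n → Z =>
      Real.exp (e * ⨆ a, ∑ i, (∫ z, f a z ∂D - f a (S i)))) (Measure.pi fun _ => D) := by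
    refine integrable_exp_iSup (M := n) he0 (fun a => Finset.measurable_sum _ fun i _ =>
      measurable_const.sub ((hf a).comp (measurable_pi_apply i))) fun a S => ?_
    have : ∑ i, (∫ z, f a z ∂D - f a (S i)) ≤ ∑ _i : Fin n, (1 : ℝ) :=
      Finset.sum_le_sum fun i _ => by linarith [hf01 a, hf0 a (S i)]
    simpa using this
  have hM := ProbabilityTheory.measure_ge_le_exp_mul_mgf
    (X := fun S : Fin n → Z => ⨆ a, ∑ i, (∫ z, f a z ∂D - f a (S i)))
    (μ := Measure.pi fun _ => D) (2 * ρ + n * e) he0 hI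
  have hle : (Measure.pi fun _ : Fin n => D).real {S | 2 * ρ + n * e
      ≤ ⨆ a, ∑ i, (∫ z, f a z ∂D - f a (S i))} ≤ Real.exp (-u) := by
    refine hM.trans ((mul_le_mul_of_nonneg_left hint (Real.exp_pos _).le).trans ?_)
    rw [← Real.exp_add]
    refine Real.exp_le_exp.2 (le_of_eq ?_)
    have : (n : ℝ) * e ^ 2 = 2 * u := by rw [he2]; field_simp
    linear_combination (-1 / 2 : ℝ) * this
  refine le_trans (measure_mono ?_) ((ENNReal.le_ofReal_iff_toReal_le (measure_ne_top _ _)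
    (Real.exp_pos _).le).2 hle)
  rintro S ⟨a, ha⟩
  refine le_trans ?_ (le_iSup_of_finite (fun a => ∑ i, (∫ z, f a z ∂D - f a (S i))) a)
  rw [Finset.sum_sub_distrib, Finset.sum_const, Finset.card_univ, Fintype.card_fin, nsmul_eq_mul]
  have := mul_le_mul_of_nonneg_left ha.le hn0.le
  rw [mul_add, mul_sub] at this
  field_simp at this
  linarith

end symmetrization

/-! ### Normalized units -/

/-- The root mean square of the `j`-th input coordinate over a data set. -/
def rms {d n : ℕ} (X : Fin n → Fin d → ℝ) (j : Fin d) : ℝ :=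
  Real.sqrt ((∑ i, X i j ^ 2) / n)

lemma rms_nonneg {d n : ℕ} (X : Fin n → Fin d → ℝ) (j : Fin d) : 0 ≤ rms X j := Real.sqrt_nonneg _

lemma natCast_mul_rms_sq {d n : ℕ} (X : Fin n → Fin d → ℝ) (j : Fin d) :
    n * rms X j ^ 2 = ∑ i, X i j ^ 2 := by
  rw [rms, Real.sq_sqrt (div_nonneg (Finset.sum_nonneg fun i _ => sq_nonneg _) (Nat.cast_nonneg n))]
  rcases Nat.eq_zero_or_pos n with rfl | hn
  · simp
  · have : (0 : ℝ) < n := by exact_mod_cast hn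
    field_simp

lemma eq_zero_of_rms_eq_zero {d n : ℕ} {X : Fin n → Fin d → ℝ} {j : Fin d} (h : rms X j = 0)
    (i : Fin n) : X i j = 0 := by
  have h1 := natCast_mul_rms_sq X j
  rw [h, zero_pow two_ne_zero, mul_zero, eq_comm,
    Finset.sum_eq_zero_iff_of_nonneg fun i _ => sq_nonneg _] at h1
  exact pow_eq_zero_iff two_ne_zero |>.1 (h1 i (Finset.mem_univ i))

/-- The activation applied to the units of layer `ℓ`; none is applied to the input. -/
def actAt (φ : ℝ → ℝ) (ℓ : ℕ) : ℝ → ℝ := if ℓ = 0 then id else φ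

namespace IsActivation

variable {φ : ℝ → ℝ}

lemma lipschitz_actAt (hφ : IsActivation φ) (ℓ : ℕ) : LipschitzWith 1 (actAt φ ℓ) := by
  unfold actAt; split_ifs; exacts [LipschitzWith.id, hφ.lipschitz]

lemma actAt_zero (hφ : IsActivation φ) (ℓ : ℕ) : actAt φ ℓ 0 = 0 := by
  unfold actAt; split_ifs; exacts [rfl, hφ.map_zero]

lemma abs_actAt_le (hφ : IsActivation φ) (ℓ : ℕ) (z : ℝ) : |actAt φ ℓ z| ≤ |z| := by
  simpa [Real.dist_eq, hφ.actAt_zero] using (hφ.lipschitz_actAt ℓ).dist_le_mul z 0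

lemma actAt_mul (hφ : IsActivation φ) (ℓ : ℕ) {a : ℝ} (ha : 0 ≤ a) (z : ℝ) :
    actAt φ ℓ (a * z) = a * actAt φ ℓ z := by
  rcases ha.eq_or_lt with rfl | ha
  · simp [hφ.actAt_zero]
  · unfold actAt; split_ifs; exacts [rfl, hφ.posHom a ha z]

end IsActivation

namespace Net

variable {d k L n : ℕ} (N : Net d k L) {φ : ℝ → ℝ}

lemma preact_succ (φ : ℝ → ℝ) (x : Fin d → ℝ) (ℓ : Fin L) (u : Fin (N.width ℓ.succ)) :
    N.preact φ x ℓ.succ u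
      = ∑ v, N.W ℓ u v * actAt φ ℓ.val (N.preact φ x ℓ.castSucc v) := by
  change (N.W ℓ *ᵥ (if ℓ.val = 0 then N.preact φ x ℓ.castSucc else
    fun i => φ (N.preact φ x ℓ.castSucc i))) u = _
  unfold actAt
  split_ifs <;> rfl

lemma partialAbsProd_succ (ℓ : Fin L) (u : Fin (N.width ℓ.succ)) (j : Fin d) :
    N.partialAbsProd ℓ.succ u j = ∑ v, |N.W ℓ u v| * N.partialAbsProd ℓ.castSucc v j := rfl

lemma partialAbsProd_nonneg (ℓ : Fin (L + 1)) (u : Fin (N.width ℓ)) (j : Fin d) :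
    0 ≤ N.partialAbsProd ℓ u j := by
  induction ℓ using Fin.induction with
  | zero =>
    change (0 : ℝ) ≤ if Fin.cast N.width_zero u = j then 1 else 0
    split_ifs <;> norm_num
  | succ ℓ ih =>
    rw [partialAbsProd_succ]
    exact Finset.sum_nonneg fun v _ => mul_nonneg (abs_nonneg _) (ih v)

lemma absProd_nonneg (c : Fin k) (j : Fin d) : 0 ≤ N.absProd c j :=
  N.partialAbsProd_nonneg (Fin.last L) (Fin.cast N.width_last.symm c) j

/-- The total weight of the paths that end at a unit, if the inputs are weighted by `w`. -/
def scale (w : Fin d → ℝ) (ℓ : Fin (L + 1)) (u : Fin (N.width ℓ)) : ℝ :=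
  ∑ j, N.partialAbsProd ℓ u j * w j

lemma scale_nonneg {w : Fin d → ℝ} (hw : ∀ j, 0 ≤ w j) (ℓ : Fin (L + 1)) (u : Fin (N.width ℓ)) :
    0 ≤ N.scale w ℓ u :=
  Finset.sum_nonneg fun j _ => mul_nonneg (N.partialAbsProd_nonneg ℓ u j) (hw j)

lemma scale_zero (w : Fin d → ℝ) (u : Fin (N.width 0)) :
    N.scale w 0 u = w (Fin.cast N.width_zero u) := by
  change ∑ j, (if Fin.cast N.width_zero u = j then (1 : ℝ) else 0) * w j = _
  simp

lemma scale_succ (w : Fin d → ℝ) (ℓ : Fin L) (u : Fin (N.width ℓ.succ)) :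
    N.scale w ℓ.succ u = ∑ v, |N.W ℓ u v| * N.scale w ℓ.castSucc v := by
  simp only [scale, partialAbsProd_succ, Finset.sum_mul, Finset.mul_sum]
  rw [Finset.sum_comm]
  simp only [mul_assoc]

lemma abs_preact_le (hφ : IsActivation φ) (x : Fin d → ℝ) (ℓ : Fin (L + 1))
    (u : Fin (N.width ℓ)) : |N.preact φ x ℓ u| ≤ N.scale (fun j => |x j|) ℓ u := by
  induction ℓ using Fin.induction with
  | zero => rw [scale_zero]; exact le_rfl
  | succ ℓ ih =>
    rw [preact_succ, scale_succ]
    refine (Finset.abs_sum_le_sum_abs _ _).trans (Finset.sum_le_sum fun v _ => ?_)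
    rw [abs_mul]
    exact mul_le_mul_of_nonneg_left ((hφ.abs_actAt_le _ _).trans (ih v)) (abs_nonneg _)

lemma abs_eval_le (hφ : IsActivation φ) (x : Fin d → ℝ) (c : Fin k) :
    |N.eval φ x c| ≤ ∑ j, N.absProd c j * |x j| :=
  N.abs_preact_le hφ x _ _

lemma preact_eq_zero_of_scale (hφ : IsActivation φ) (X : Fin n → Fin d → ℝ) (ℓ : Fin (L + 1))
    (u : Fin (N.width ℓ)) (h : N.scale (rms X) ℓ u = 0) (i : Fin n) :
    N.preact φ (X i) ℓ u = 0 := by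
  rw [scale, Finset.sum_eq_zero_iff_of_nonneg fun j _ =>
    mul_nonneg (N.partialAbsProd_nonneg ℓ u j) (rms_nonneg X j)] at h
  refine abs_nonpos_iff.1 ((N.abs_preact_le hφ (X i) ℓ u).trans (le_of_eq ?_))
  refine Finset.sum_eq_zero fun j hj => ?_
  rcases mul_eq_zero.1 (h j hj) with h | h
  · simp [h]
  · simp [eq_zero_of_rms_eq_zero h i]

/-- The values of a unit on a data set, normalized by its scale. -/
def normUnit (φ : ℝ → ℝ) (X : Fin n → Fin d → ℝ) (ℓ : Fin (L + 1)) (u : Fin (N.width ℓ))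
    (i : Fin n) : ℝ :=
  N.preact φ (X i) ℓ u / N.scale (rms X) ℓ u

/-- A unit of scale `0` vanishes on the whole data set, so the convention `x / 0 = 0` loses nothing.
-/
lemma scale_mul_normUnit (hφ : IsActivation φ) (X : Fin n → Fin d → ℝ) (ℓ : Fin (L + 1))
    (u : Fin (N.width ℓ)) (i : Fin n) :
    N.scale (rms X) ℓ u * N.normUnit φ X ℓ u i = N.preact φ (X i) ℓ u := by
  by_cases h : N.scale (rms X) ℓ u = 0
  · rw [h, zero_mul, N.preact_eq_zero_of_scale hφ X ℓ u h]
  · exact mul_div_cancel₀ _ h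

/-- Positive homogeneity pulls the scale of each lower unit out of its activation. -/
lemma normUnit_succ (hφ : IsActivation φ) (X : Fin n → Fin d → ℝ) (ℓ : Fin L)
    (u : Fin (N.width ℓ.succ)) (i : Fin n) :
    N.normUnit φ X ℓ.succ u i = ∑ v, N.W ℓ u v * N.scale (rms X) ℓ.castSucc v
      / N.scale (rms X) ℓ.succ u * actAt φ ℓ.val (N.normUnit φ X ℓ.castSucc v i) := by
  rw [normUnit, preact_succ, Finset.sum_div]
  refine Finset.sum_congr rfl fun v _ => ?_
  rw [← N.scale_mul_normUnit hφ X ℓ.castSucc v i,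
    hφ.actAt_mul _ (N.scale_nonneg (rms_nonneg X) _ _)]
  ring

/-- The numerators add up to the denominator by the recursion for `scale`. The sum is `1`, or `0`
for a unit of scale `0`. -/
lemma sum_abs_normalized_weight_le (X : Fin n → Fin d → ℝ) (ℓ : Fin L)
    (u : Fin (N.width ℓ.succ)) :
    ∑ v, |N.W ℓ u v * N.scale (rms X) ℓ.castSucc v / N.scale (rms X) ℓ.succ u| ≤ 1 := by
  have h : ∀ v, |N.W ℓ u v * N.scale (rms X) ℓ.castSucc v / N.scale (rms X) ℓ.succ u|
      = |N.W ℓ u v| * N.scale (rms X) ℓ.castSucc v / N.scale (rms X) ℓ.succ u := fun v => by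
    rw [abs_div, abs_mul, abs_of_nonneg (N.scale_nonneg (rms_nonneg X) _ v),
      abs_of_nonneg (N.scale_nonneg (rms_nonneg X) _ u)]
  simp only [h]
  rw [← Finset.sum_div, ← scale_succ]
  exact div_self_le_one _

variable {ι : Type*} [Finite ι] (F : ι → Net d k L)

/-- The normalized units of layer `ℓ` of a family of networks, together with `0`. -/
def layerFamily (φ : ℝ → ℝ) (X : Fin n → Fin d → ℝ) (ℓ : Fin (L + 1)) :
    Option (Σ a, Fin ((F a).width ℓ)) → Fin n → ℝ
  | none => 0
  | some p => (F p.1).normUnit φ X ℓ p.2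

/-- The exponential moments of the Rademacher process indexed by the normalized units. -/
lemma expect_exp_layerFamily_le (hφ : IsActivation φ) (X : Fin n → Fin d → ℝ) {l : ℝ}
    (hl : 0 ≤ l) (ℓ : Fin (L + 1)) :
    𝔼 σ : Fin n → Bool, Real.exp (l * ⨆ p, |∑ i, sgn (σ i) * layerFamily F φ X ℓ p i|)
      ≤ 2 ^ ℓ.val * (2 * (d + 1)) * Real.exp (l ^ 2 * n / 2) := by
  induction ℓ using Fin.induction with
  | zero =>
    -- All networks share the input layer, so however large the family, there are only `d + 1`
    -- functions here, each with square sum at most `n`.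
    set t : Option (Fin d) → Fin n → ℝ := fun o => o.elim 0 fun j i => X i j / rms X j with ht
    calc _ ≤ 𝔼 σ : Fin n → Bool, Real.exp (l * ⨆ o, |∑ i, sgn (σ i) * t o i|) := by
          refine expect_le_expect' fun σ => Real.exp_le_exp.2 (mul_le_mul_of_nonneg_left ?_ hl)
          refine ciSup_le fun p => ?_
          have hle := le_iSup_of_finite fun o => |∑ i, sgn (σ i) * t o i|
          rcases p with _ | ⟨a, u⟩
          · exact hle none
          · refine le_trans (le_of_eq ?_) (hle (some (Fin.cast (F a).width_zero u)))
            simp only [layerFamily, normUnit, scale_zero]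
            rfl
      _ ≤ 2 * Fintype.card (Option (Fin d)) * Real.exp (l ^ 2 * n / 2) := by
          refine expect_exp_iSup_abs_le_card hl t fun o => ?_
          rcases o with _ | j
          · simp [ht]
          · simp only [ht, Option.elim, div_pow]
            rw [← Finset.sum_div, ← natCast_mul_rms_sq, mul_div_assoc]
            exact mul_le_of_le_one_right (Nat.cast_nonneg n) (div_self_le_one _)
      _ = _ := by simp
  | succ ℓ ih =>
    calc _ ≤ 2 * 𝔼 σ : Fin n → Bool,
          Real.exp (l * ⨆ p, |∑ i, sgn (σ i) * layerFamily F φ X ℓ.castSucc p i|) := by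
          refine expect_exp_iSup_abs_convex_le hl (hφ.lipschitz_actAt ℓ.val)
            (hφ.actAt_zero ℓ.val) _ _ fun p => ?_
          rcases p with _ | ⟨a, u⟩
          -- The zero function, present so that the index type is nonempty even for layers of width
          -- `0`, is the empty combination.
          · exact ⟨0, 0, fun _ => none, by simp, fun i => by simp [layerFamily]⟩
          · exact ⟨(F a).width ℓ.castSucc, fun v => (F a).W ℓ u v *
              (F a).scale (rms X) ℓ.castSucc v / (F a).scale (rms X) ℓ.succ u,
              fun v => some ⟨a, v⟩, (F a).sum_abs_normalized_weight_le X ℓ u,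
              fun i => (F a).normUnit_succ hφ X ℓ u i⟩
      _ ≤ 2 * (2 ^ ℓ.val * (2 * (d + 1)) * Real.exp (l ^ 2 * n / 2)) :=
          mul_le_mul_of_nonneg_left ih zero_le_two
      _ = _ := by rw [Fin.val_succ, pow_succ]; ring

end Net

/-! ### Reduction to polynomially many outputs -/

/-- Jensen's inequality, from the tangent line of `exp` at the mean. -/
lemma exp_expect_le {α : Type*} [Fintype α] [Nonempty α] (x : α → ℝ) :
    Real.exp (𝔼 a, x a) ≤ 𝔼 a, Real.exp (x a) := by
  set m := 𝔼 a, x a with hm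
  have h : ∀ a, Real.exp m * (1 + (x a - m)) ≤ Real.exp (x a) := fun a => by
    have := mul_le_mul_of_nonneg_left (Real.add_one_le_exp (x a - m)) (Real.exp_pos m).le
    rwa [← Real.exp_add, add_sub_cancel, add_comm (x a - m)] at this
  refine le_trans (le_of_eq ?_) (expect_le_expect' h)
  rw [← Finset.mul_expect, Finset.expect_add_distrib, Finset.expect_sub_distrib,
    Fintype.expect_const, Fintype.expect_const, ← hm]
  ring

lemma expect_apply_eq {α T : Type*} [Fintype α] [DecidableEq α] [Fintype T] [Nonempty T]
    (s : α) (G : T → ℝ) : 𝔼 f : α → T, G (f s) = 𝔼 x, G x := by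
  rw [Fintype.expect_equiv (Equiv.funSplitAt s T) (fun f => G (f s)) (fun p => G p.1)
    fun _ => rfl, ← Finset.univ_product_univ,
    Finset.expect_product' Finset.univ Finset.univ fun x _ => G x]
  simp only [Fintype.expect_const]

lemma expect_column_eq {α : Type*} [Fintype α] [DecidableEq α] {n : ℕ} (s : α)
    (G : (Fin n → Bool) → ℝ) : 𝔼 τ : Fin n → α → Bool, G (fun i => τ i s) = 𝔼 σ, G σ := by
  rw [← expect_apply_eq s G]
  exact Fintype.expect_equiv (Equiv.piComm fun (_ : Fin n) (_ : α) => Bool) _ _ fun _ => rfl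

/-- Rademacher averages of nonnegative combinations, one for each of finitely many outputs. -/
lemma expect_iSup_outputs_le {ι κ α : Type*} [Nonempty ι] [Finite κ] [Nonempty κ]
    [Fintype α] [Nonempty α] [DecidableEq α] {n : ℕ} (hn : 1 ≤ n) (t : κ → Fin n → ℝ)
    {E₀ Λ b : ℝ} (hb : 0 ≤ b) (hΛ : 0 < Λ) (hE : Fintype.card α * E₀ ≤ Real.exp Λ)
    (ht : ∀ l : ℝ, 0 ≤ l → 𝔼 σ : Fin n → Bool,
      Real.exp (l * ⨆ p, |∑ i, sgn (σ i) * t p i|) ≤ E₀ * Real.exp (l ^ 2 * n / 2))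
    (β : ι → α → ℝ) (hβ : ∀ a s, 0 ≤ β a s) (hβb : ∀ a, ∑ s, β a s ≤ b) (e : ι → α → κ) :
    𝔼 τ : Fin n → α → Bool, (⨆ a, ∑ i, ∑ s, sgn (τ i s) * (β a s * t (e a s) i))
      ≤ b * Real.sqrt (2 * n * Λ) := by
  have hn0 : (0 : ℝ) < n := by exact_mod_cast hn
  set M : (Fin n → α → Bool) → ℝ := fun τ => ⨆ s, ⨆ p, |∑ i, sgn (τ i s) * t p i| with hM
  have hMs : ∀ τ s p, |∑ i, sgn (τ i s) * t p i| ≤ M τ := fun τ s p =>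
    (le_iSup_of_finite (fun p => |∑ i, sgn (τ i s) * t p i|) p).trans
      (le_iSup_of_finite (fun s => ⨆ p, |∑ i, sgn (τ i s) * t p i|) s)
  have h1 : ∀ τ, (⨆ a, ∑ i, ∑ s, sgn (τ i s) * (β a s * t (e a s) i)) ≤ b * M τ := by
    intro τ
    have hM0 : 0 ≤ M τ := (abs_nonneg _).trans
      (hMs τ (Classical.arbitrary α) (Classical.arbitrary κ))
    refine ciSup_le fun a => ?_
    rw [Finset.sum_comm]
    calc ∑ s, ∑ i, sgn (τ i s) * (β a s * t (e a s) i)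
        ≤ ∑ s, β a s * M τ := by
          refine Finset.sum_le_sum fun s _ => ?_
          simp only [mul_left_comm _ (β a s), ← Finset.mul_sum]
          exact mul_le_mul_of_nonneg_left ((le_abs_self _).trans (hMs τ s (e a s))) (hβ a s)
      _ ≤ b * M τ := by
          rw [← Finset.sum_mul]
          exact mul_le_mul_of_nonneg_right (hβb a) hM0
  refine (expect_le_expect' h1).trans ?_
  rw [← Finset.mul_expect]
  refine mul_le_mul_of_nonneg_left ?_ hb
  -- This choice balances `Λ` against `l ^ 2 * n / 2`.
  set l := Real.sqrt (2 * Λ / n) with hl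
  have hl0 : 0 < l := Real.sqrt_pos.2 (by positivity)
  have hl2 : l ^ 2 = 2 * Λ / n := Real.sq_sqrt (by positivity)
  have h2 : Real.exp (l * 𝔼 τ, M τ) ≤ Real.exp (Λ + l ^ 2 * n / 2) := by
    rw [Finset.mul_expect]
    calc Real.exp (𝔼 τ, l * M τ) ≤ 𝔼 τ, Real.exp (l * M τ) := exp_expect_le _
      _ ≤ 𝔼 τ : Fin n → α → Bool, ∑ s, Real.exp (l * ⨆ p, |∑ i, sgn (τ i s) * t p i|) := by
          refine expect_le_expect' fun τ => ?_
          rw [hM, Real.mul_iSup_of_nonneg hl0.le]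
          exact exp_iSup_le_sum _
      _ = ∑ s : α, 𝔼 σ : Fin n → Bool, Real.exp (l * ⨆ p, |∑ i, sgn (σ i) * t p i|) := by
          rw [Finset.expect_sum_comm]
          exact Finset.sum_congr rfl fun s _ => expect_column_eq s
            fun σ => Real.exp (l * ⨆ p, |∑ i, sgn (σ i) * t p i|)
      _ ≤ ∑ _s : α, E₀ * Real.exp (l ^ 2 * n / 2) := Finset.sum_le_sum fun s _ => ht l hl0.le
      _ ≤ _ := by
          rw [Finset.sum_const, Finset.card_univ, nsmul_eq_mul, ← mul_assoc, Real.exp_add]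
          exact mul_le_mul_of_nonneg_right hE (Real.exp_pos _).le
  have h3 := Real.exp_le_exp.1 h2
  have h4 : Λ + l ^ 2 * n / 2 = l * Real.sqrt (2 * n * Λ) := by
    have : l * Real.sqrt (2 * n * Λ) = 2 * Λ := by
      rw [hl, ← Real.sqrt_mul (by positivity),
        show 2 * Λ / n * (2 * n * Λ) = (2 * Λ) ^ 2 by field_simp, Real.sqrt_sq (by positivity)]
    rw [this, hl2]
    field_simp
    ring
  rw [h4] at h3
  exact le_of_mul_le_mul_left h3 hl0

/-- A competitor `j` may be matched with a different competitor `j'`. This freedom allows outputs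
outside the chosen slots to be replaced, at the price `η`. -/
lemma margin_sub_le {k : ℕ} {v v' : Fin k → ℝ} {y : Fin k} {δ η : ℝ} (hk : 2 ≤ k)
    (hy : v y - v' y ≤ δ) (h : ∀ j, j ≠ y → ∃ j', j' ≠ y ∧ v' j ≤ v j' + δ + η) :
    margin v y - margin v' y ≤ 2 * δ + η := by
  have : Nontrivial (Fin k) := Fin.nontrivial_iff_two_le.2 hk
  obtain ⟨j₀, hj₀⟩ := exists_ne y
  have : Nonempty {j : Fin k // j ≠ y} := ⟨⟨j₀, hj₀⟩⟩
  have h1 : (⨆ j : {j : Fin k // j ≠ y}, v' j) ≤ (⨆ j : {j : Fin k // j ≠ y}, v j) + δ + η := by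
    refine ciSup_le fun j => ?_
    obtain ⟨j', hj', hle⟩ := h j j.2
    have := le_iSup_of_finite (fun j : {j : Fin k // j ≠ y} => v j) ⟨j', hj'⟩
    simp only at this
    linarith
  unfold margin
  linarith

/-- For the margins on a data set only polynomially many output units matter. -/
lemma exists_output_slots {ι : Type*} {k n : ℕ} (hk : 2 ≤ k) (hn : 1 ≤ n)
    (v : ι → Fin n → Fin k → ℝ) {b : ℝ} (hb : 0 < b) (hv : ∀ a i, ∑ c, |v a i c| ≤ b)
    (y : Fin n → Fin k) :
    ∃ (α : Type) (_ : Fintype α) (_ : DecidableEq α) (_ : Nonempty α) (e : ι → α → Fin k),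
      Fintype.card α ≤ n + n ^ 2 + 1 ∧ (∀ a, Function.Injective (e a)) ∧
      ∀ i a a', ∃ s, margin (v a i) (y i) - margin (v a' i) (y i)
        ≤ 2 * |v a i (e a s) - v a' i (e a' s)| + 2 * b / n := by
  have hn0 : (0 : ℝ) < n := by exact_mod_cast hn
  have hη : 0 ≤ 2 * b / n := by positivity
  rcases le_or_gt k (n + n ^ 2 + 1) with hkn | hkn
  · have : Nonempty (Fin k) := ⟨y ⟨0, hn⟩⟩
    refine ⟨Fin k, inferInstance, inferInstance, this, fun _ => id, by simpa using hkn,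
      fun _ => Function.injective_id, fun i a a' => ?_⟩
    obtain ⟨s, hs⟩ := exists_eq_ciSup_of_finite (f := fun s => |v a i s - v a' i s|)
    have hmax := le_iSup_of_finite fun s => |v a i s - v a' i s|
    rw [← hs] at hmax
    refine ⟨s, margin_sub_le hk ((le_abs_self _).trans (hmax _)) fun j hj => ⟨j, hj, ?_⟩⟩
    have := (neg_le_abs _).trans (hmax j)
    simp only [id] at *
    linarith
  -- The slots are the labels `Y` occurring in the data, shared by all `a`, and `n ^ 2 + 1` further
  -- outputs depending on `a`, which include every unlabelled output exceeding `θ` at some data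
  -- point.
  · set θ : ℝ := b / n with hθ
    have hθ0 : 0 < θ := by positivity
    set Y : Finset (Fin k) := Finset.univ.image y with hY
    have hyY : ∀ i, y i ∈ Y := fun i => Finset.mem_image_of_mem _ (Finset.mem_univ i)
    have hYcard : Y.card ≤ n := by simpa using Finset.card_image_le (s := Finset.univ) (f := y)
    set B : ι → Finset (Fin k) := fun a => {c | c ∉ Y ∧ ∃ i, θ < |v a i c|} with hB
    have hBcard : ∀ a, (B a).card ≤ n ^ 2 := by
      intro a
      have hsub : B a ⊆ Finset.univ.biUnion fun i => {c | θ < |v a i c|} := by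
        intro c hc
        obtain ⟨-, i, hi⟩ := (Finset.mem_filter.1 hc).2
        exact Finset.mem_biUnion.2 ⟨i, Finset.mem_univ i, by simpa using hi⟩
      refine (Finset.card_le_card hsub).trans (Finset.card_biUnion_le.trans ?_)
      have h1 : ∀ i, Finset.card {c | θ < |v a i c|} ≤ n := by
        intro i
        have h2 : (Finset.card {c | θ < |v a i c|} : ℝ) * θ ≤ b := by
          calc (Finset.card {c | θ < |v a i c|} : ℝ) * θ
              = ∑ _c ∈ ({c | θ < |v a i c|} : Finset (Fin k)), θ := by simp
            _ ≤ ∑ c ∈ ({c | θ < |v a i c|} : Finset (Fin k)), |v a i c| :=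
                Finset.sum_le_sum fun c hc => (Finset.mem_filter.1 hc).2.le
            _ ≤ ∑ c, |v a i c| := Finset.sum_le_sum_of_subset_of_nonneg (Finset.subset_univ _)
                fun c _ _ => abs_nonneg _
            _ ≤ b := hv a i
        have h3 : (Finset.card {c | θ < |v a i c|} : ℝ) * b ≤ n * b := by
          rw [hθ, ← mul_div_assoc, div_le_iff₀ hn0] at h2
          linarith
        exact_mod_cast le_of_mul_le_mul_right h3 hb
      refine (Finset.sum_le_sum fun i _ => h1 i).trans (le_of_eq ?_)
      simp [sq]
    -- Equal cardinalities let slots of different `a` be compared index by index; the extra `+ 1`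
    -- guarantees that each `A a` contains an output that is small on all data.
    have hA : ∀ a, ∃ A : Finset (Fin k), B a ⊆ A ∧ A ⊆ Yᶜ ∧ A.card = n ^ 2 + 1 := by
      intro a
      refine Finset.exists_subsuperset_card_eq (fun c hc => ?_) ((hBcard a).trans (by omega)) ?_
      · exact Finset.mem_compl.2 (Finset.mem_filter.1 hc).2.1
      · rw [Finset.card_compl, Fintype.card_fin]; omega
    choose A hBA hAY hAcard using hA
    set enum : ∀ a, Fin (n ^ 2 + 1) ≃ A a := fun a => ((A a).equivFinOfCardEq (hAcard a)).symm
    have henum : ∀ a l, (enum a l : Fin k) ∉ Y := fun a l =>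
      Finset.mem_compl.1 (hAY a (enum a l).2)
    set e : ι → Y ⊕ Fin (n ^ 2 + 1) → Fin k :=
      fun a => Sum.elim (fun c => c) fun l => enum a l with he
    refine ⟨Y ⊕ Fin (n ^ 2 + 1), inferInstance, inferInstance, inferInstance, e, ?_, ?_, ?_⟩
    · simp only [Fintype.card_sum, Fintype.card_coe, Fintype.card_fin]; omega
    · intro a
      refine Function.Injective.sumElim Subtype.val_injective
        (Subtype.val_injective.comp (enum a).injective) fun c l h => henum a l ?_
      rw [← h]
      exact c.2
    · intro i a a'
      obtain ⟨s, hs⟩ := exists_eq_ciSup_of_finite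
        (f := fun s => |v a i (e a s) - v a' i (e a' s)|)
      have hmax := le_iSup_of_finite fun s => |v a i (e a s) - v a' i (e a' s)|
      rw [← hs] at hmax
      have hη' : 2 * b / n = θ + θ := by rw [hθ]; ring
      refine ⟨s, margin_sub_le hk ((le_abs_self _).trans (hmax (Sum.inl ⟨y i, hyY i⟩)))
        fun j hj => ?_⟩
      by_cases hjY : j ∈ Y
      · refine ⟨j, hj, ?_⟩
        have : -(v a i j - v a' i j) ≤ _ := (neg_le_abs _).trans (hmax (Sum.inl ⟨j, hjY⟩))
        linarith
      by_cases hjA : j ∈ A a'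
      -- The partner of `j` is the output that `a` keeps in the slot where `a'` keeps `j`.
      · obtain ⟨l, hl⟩ := (enum a').surjective ⟨j, hjA⟩
        refine ⟨enum a l, fun h => henum a l (h ▸ hyY i), ?_⟩
        have : -(v a i (enum a l) - v a' i (enum a' l)) ≤ _ :=
          (neg_le_abs _).trans (hmax (Sum.inr l))
        rw [hl] at this
        simp only at this
        linarith
      -- An output of `a'` without a slot is small; its partner is the spare small output `c` of
      -- `a`, and the two differ by at most `θ + θ = η`.
      · have hjs : |v a' i j| ≤ θ := by
          by_contra hlt
          exact hjA (hBA a' (Finset.mem_filter.2 ⟨Finset.mem_univ j, hjY, i, not_le.1 hlt⟩))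
        obtain ⟨c, hcA, hcB⟩ : ∃ c ∈ A a, c ∉ B a := by
          by_contra! hsub
          have := Finset.card_le_card hsub
          have := hBcard a
          have := hAcard a
          omega
        have hcY : c ∉ Y := Finset.mem_compl.1 (hAY a hcA)
        have hcs : |v a i c| ≤ θ := by
          by_contra hlt
          exact hcB (Finset.mem_filter.2 ⟨Finset.mem_univ c, hcY, i, not_le.1 hlt⟩)
        refine ⟨c, fun h => hcY (h ▸ hyY i), ?_⟩
        have h1 := (le_abs_self _).trans hjs
        have h2 := (neg_le_abs _).trans hcs
        have h3 : 0 ≤ |v a i (e a s) - v a' i (e a' s)| := abs_nonneg _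
        linarith

/-- The ramp: `1` on `(-∞, 0]`, `0` on `[1, ∞)`, and linear in between. -/
def ramp (x : ℝ) : ℝ := max 0 (min 1 (1 - x))

lemma ramp_nonneg (x : ℝ) : 0 ≤ ramp x := le_max_left _ _

lemma ramp_le_one (x : ℝ) : ramp x ≤ 1 := max_le zero_le_one (min_le_left _ _)

lemma continuous_ramp : Continuous ramp := by unfold ramp; fun_prop

lemma ramp_sub_le {x y c : ℝ} (hc : 0 ≤ c) (h : y - x ≤ c) : ramp x - ramp y ≤ c := by
  unfold ramp
  rcases max_cases 0 (min 1 (1 - x)) with ⟨h1, _⟩ | ⟨h1, _⟩ <;>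
  rcases max_cases 0 (min 1 (1 - y)) with ⟨h2, _⟩ | ⟨h2, _⟩ <;>
  rcases min_cases 1 (1 - x) with ⟨h3, _⟩ | ⟨h3, _⟩ <;>
  rcases min_cases 1 (1 - y) with ⟨h4, _⟩ | ⟨h4, _⟩ <;> rw [h1, h2] <;> linarith

/-- The Rademacher averages of the ramp losses of a finite family of networks. -/
lemma expect_iSup_ramp_margin_le {ι : Type*} [Finite ι] [Nonempty ι] {d k L n : ℕ} (hk : 2 ≤ k)
    (hn : 1 ≤ n) {φ : ℝ → ℝ} (hφ : IsActivation φ) (F : ι → Net d k L) (γ : ι → ℝ)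
    (hγ : ∀ a, 0 < γ a) (X : Fin n → Fin d → ℝ) (y : Fin n → Fin k) {b Λ : ℝ} (hb : 0 < b)
    (hrms : ∀ a, ∑ c, ∑ j, (F a).absProd c j * rms X j ≤ b * γ a)
    (hX : ∀ a i, ∑ c, ∑ j, (F a).absProd c j * |X i j| ≤ b * γ a) (hΛ : 0 < Λ)
    (hE : ((n : ℝ) + n ^ 2 + 1) * (2 ^ L * (2 * (d + 1))) ≤ Real.exp Λ)
    (g : ι → Fin n → ℝ) (hg : ∀ i, (∀ a, g a i = 0) ∨
      ∀ a, g a i = ramp (margin (fun c => (F a).eval φ (X i) c / γ a) (y i))) :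
    𝔼 σ : Fin n → Bool, (⨆ a, ∑ i, sgn (σ i) * g a i) ≤ 2 * b * Real.sqrt (2 * n * Λ) + b := by
  have hn0 : (0 : ℝ) < n := by exact_mod_cast hn
  set v : ι → Fin n → Fin k → ℝ := fun a i c => (F a).eval φ (X i) c / γ a with hv
  have hvb : ∀ a i, ∑ c, |v a i c| ≤ b := by
    intro a i
    simp only [hv, abs_div, abs_of_pos (hγ a)]
    rw [← Finset.sum_div, div_le_iff₀ (hγ a)]
    exact (Finset.sum_le_sum fun c _ => (F a).abs_eval_le hφ (X i) c).trans (hX a i)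
  obtain ⟨α, _, _, _, e, hcard, hinj, hm⟩ := exists_output_slots hk hn v hb hvb y
  have h1 := expect_iSup_le_vector g (fun a i s => 2 * v a i (e a s)) (2 * b / n) (by
    intro i a a'
    obtain ⟨s, hs⟩ := hm i a' a
    refine ⟨s, ?_⟩
    have hpos : 0 ≤ 2 * |v a i (e a s) - v a' i (e a' s)| + 2 * b / n := by positivity
    rw [← mul_sub, abs_mul, abs_two]
    rcases hg i with h | h
    · rw [h, h, sub_zero]; exact hpos
    · rw [h, h]
      exact ramp_sub_le hpos (by rwa [abs_sub_comm]))
  have h2 := expect_iSup_outputs_le (α := α) (b := 2 * b) hn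
    (Net.layerFamily F φ X (Fin.last L)) (by positivity) hΛ
    (E₀ := 2 ^ L * (2 * (d + 1)))
    (le_trans (mul_le_mul_of_nonneg_right (by exact_mod_cast hcard) (by positivity)) hE)
    (fun l hl => Net.expect_exp_layerFamily_le F hφ X hl (Fin.last L))
    (fun a s => 2 * ((∑ j, (F a).absProd (e a s) j * rms X j) / γ a))
    (fun a s => mul_nonneg zero_le_two (div_nonneg (Finset.sum_nonneg fun j _ =>
      mul_nonneg ((F a).absProd_nonneg _ _) (rms_nonneg X j)) (hγ a).le))
    (fun a => by
      rw [← Finset.mul_sum, ← Finset.sum_div]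
      refine mul_le_mul_of_nonneg_left ?_ zero_le_two
      rw [div_le_iff₀ (hγ a)]
      refine le_trans ?_ (hrms a)
      -- Distinct slots hold distinct outputs, so their scales add up to at most the sum over all
      -- outputs.
      have := Finset.sum_le_univ_sum_of_nonneg (s := Finset.univ.map ⟨e a, hinj a⟩)
        (f := fun c => ∑ j, (F a).absProd c j * rms X j) fun c =>
          Finset.sum_nonneg fun j _ => mul_nonneg ((F a).absProd_nonneg _ _) (rms_nonneg X j)
      simpa using this)
    (fun a s => some ⟨a, Fin.cast (F a).width_last.symm (e a s)⟩)
  refine h1.trans (add_le_add (le_trans (le_of_eq ?_) h2) (le_of_eq (by field_simp)))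
  refine Finset.expect_congr rfl fun τ _ => ?_
  congr 1
  funext a
  refine Finset.sum_congr rfl fun i _ => Finset.sum_congr rfl fun s _ => ?_
  have : (F a).eval φ (X i) (e a s) = (∑ j, (F a).absProd (e a s) j * rms X j) *
      (F a).normUnit φ X (Fin.last L) (Fin.cast (F a).width_last.symm (e a s)) i :=
    ((F a).scale_mul_normUnit hφ X (Fin.last L) _ i).symm
  simp only [hv, Net.layerFamily, this]
  ring

/-! ### Measurability and reduction to countable families -/

lemma continuous_margin {k : ℕ} (hk : 2 ≤ k) (y : Fin k) :
    Continuous fun v : Fin k → ℝ => margin v y := by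
  refine (LipschitzWith.of_le_add_mul 2 fun v v' => ?_).continuous
  have h : ∀ j, |v j - v' j| ≤ dist v v' := fun j => by
    rw [← Real.dist_eq]; exact dist_le_pi_dist v v' j
  have := margin_sub_le (v := v) (v' := v') (y := y) (δ := dist v v') (η := 0) hk
    ((le_abs_self _).trans (h y)) fun j hj => ⟨j, hj, by linarith [(neg_le_abs _).trans (h j)]⟩
  simp only [NNReal.coe_ofNat]
  linarith

lemma continuous_vecNorm {ι : Type*} [Fintype ι] (p : ℝ≥0∞) [Fact (1 ≤ p)] :
    Continuous fun v : ι → ℝ => vecNorm p v :=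
  continuous_norm.comp (PiLp.continuous_toLp p fun _ : ι => ℝ)

lemma vecNorm_nonneg {ι : Type*} [Fintype ι] (p : ℝ≥0∞) [Fact (1 ≤ p)] (v : ι → ℝ) :
    0 ≤ vecNorm p v := norm_nonneg _

lemma vecNorm_zero {ι : Type*} [Fintype ι] (p : ℝ≥0∞) [Fact (1 ≤ p)] :
    vecNorm p (0 : ι → ℝ) = 0 := by simp [vecNorm]

lemma vecNorm_top_le_iff {ι : Type*} [Fintype ι] {v : ι → ℝ} {r : ℝ} (hr : 0 ≤ r) :
    vecNorm ∞ v ≤ r ↔ ∀ j, |v j| ≤ r := by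
  unfold vecNorm
  rw [PiLp.norm_toLp, pi_norm_le_iff_of_nonneg hr]
  rfl

lemma vecNorm_eq_sum {ι : Type*} [Fintype ι] {p : ℝ≥0∞} (hp : 0 < p.toReal) (v : ι → ℝ) :
    vecNorm p v = (∑ j, |v j| ^ p.toReal) ^ (1 / p.toReal) := by
  unfold vecNorm
  rw [PiLp.norm_eq_sum hp]
  rfl

/-- For finite `p`, the power mean inequality gives `rms ^ p ≤` mean of `|X i j| ^ p` in each
coordinate, because `p / 2 ≥ 1`; then the sums over coordinates and samples are exchanged. The case
`p = ∞` is coordinatewise. -/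
lemma vecNorm_rms_le {d n : ℕ} (hn : 1 ≤ n) {p : ℝ≥0∞} (hp : 2 ≤ p) {X : Fin n → Fin d → ℝ}
    {r : ℝ} (hr : 0 ≤ r) (hX : ∀ i, vecNorm p (X i) ≤ r) : vecNorm p (rms X) ≤ r := by
  have hn0 : (0 : ℝ) < n := by exact_mod_cast hn
  rcases eq_or_ne p ∞ with rfl | hpt
  · rw [vecNorm_top_le_iff hr]
    intro j
    rw [abs_of_nonneg (rms_nonneg X j), rms, Real.sqrt_le_left hr, div_le_iff₀ hn0]
    calc ∑ i, X i j ^ 2 ≤ ∑ _i : Fin n, r ^ 2 := Finset.sum_le_sum fun i _ =>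
          sq_le_sq' (by linarith [neg_le_abs (X i j), (vecNorm_top_le_iff hr).1 (hX i) j])
            ((le_abs_self _).trans ((vecNorm_top_le_iff hr).1 (hX i) j))
      _ = r ^ 2 * n := by simp [mul_comm]
  · set s := p.toReal with hs
    have hs2 : 2 ≤ s := by
      have := ENNReal.toReal_mono hpt hp
      simpa using this
    have hs0 : 0 < s := by linarith
    have key : ∀ v : Fin d → ℝ, vecNorm p v ≤ r ↔ ∑ j, |v j| ^ s ≤ r ^ s := fun v => by
      rw [vecNorm_eq_sum hs0, ← Real.rpow_le_rpow_iff (z := s) (Real.rpow_nonneg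
        (Finset.sum_nonneg fun j _ => Real.rpow_nonneg (abs_nonneg _) _) _) hr hs0,
        ← Real.rpow_mul (Finset.sum_nonneg fun j _ => Real.rpow_nonneg (abs_nonneg _) _),
        one_div_mul_cancel hs0.ne', Real.rpow_one]
    rw [key]
    have h1 : ∀ j, |rms X j| ^ s ≤ ∑ i, (1 / (n : ℝ)) * |X i j| ^ s := by
      intro j
      have h2 : ∀ a : ℝ, 0 ≤ a → a ^ s = (a ^ 2) ^ (s / 2) := fun a ha => by
        rw [← Real.rpow_natCast, ← Real.rpow_mul ha]; congr 1; push_cast; ring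
      rw [h2 _ (abs_nonneg _), sq_abs, rms, Real.sq_sqrt
        (div_nonneg (Finset.sum_nonneg fun i _ => sq_nonneg _) hn0.le), div_eq_inv_mul,
        Finset.mul_sum]
      refine (Real.rpow_arith_mean_le_arith_mean_rpow Finset.univ (fun _ => (n : ℝ)⁻¹)
        (fun i => X i j ^ 2) (fun _ _ => by positivity) ?_ (fun i _ => sq_nonneg _)
        (by linarith)).trans (le_of_eq ?_)
      · simp [hn0.ne']
      · refine Finset.sum_congr rfl fun i _ => ?_
        rw [h2 _ (abs_nonneg _), sq_abs, one_div]
    calc ∑ j, |rms X j| ^ s ≤ ∑ j, ∑ i, (1 / (n : ℝ)) * |X i j| ^ s :=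
          Finset.sum_le_sum fun j _ => h1 j
      _ = ∑ i, (1 / (n : ℝ)) * ∑ j, |X i j| ^ s := by
          rw [Finset.sum_comm]; simp only [Finset.mul_sum]
      _ ≤ ∑ _i : Fin n, (1 / (n : ℝ)) * r ^ s := Finset.sum_le_sum fun i _ =>
          mul_le_mul_of_nonneg_left ((key _).1 (hX i)) (by positivity)
      _ = r ^ s := by simp; field_simp

/-- Continuity from below along finite subunions; the sets need not be measurable. -/
lemma measure_iUnion_le_of_finset {α ι : Type*} [MeasurableSpace α] [Countable ι] (μ : Measure α)
    (A : ι → Set α) {c : ℝ≥0∞} (h : ∀ T : Finset ι, μ (⋃ j ∈ T, A j) ≤ c) : μ (⋃ j, A j) ≤ c := by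
  rw [Set.iUnion_eq_iUnion_finset, Directed.measure_iUnion]
  · exact iSup_le h
  · intro s t
    classical
    exact ⟨s ∪ t, Set.biUnion_subset_biUnion_left fun _ h => Finset.mem_union_left t h,
      Set.biUnion_subset_biUnion_left fun _ h => Finset.mem_union_right s h⟩

namespace Net

variable {d k L n : ℕ} {φ : ℝ → ℝ}

/-- The weights of the networks with given widths. -/
abbrev Weights (L : ℕ) (m : Fin (L + 1) → ℕ) : Type :=
  ∀ ℓ : Fin L, Fin (m ℓ.succ) → Fin (m ℓ.castSucc) → ℝ

/-- The network with given widths and weights. -/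
def ofWeights (m : Fin (L + 1) → ℕ) (h0 : m 0 = d) (hL : m (Fin.last L) = k)
    (W : Weights L m) : Net d k L :=
  ⟨m, h0, hL, fun ℓ => Matrix.of (W ℓ)⟩

lemma _root_.PathNorm.IsActivation.continuous_actAt (hφ : IsActivation φ) (ℓ : ℕ) :
    Continuous (actAt φ ℓ) := (hφ.lipschitz_actAt ℓ).continuous

lemma continuous_preact_ofWeights (hφ : IsActivation φ) (m : Fin (L + 1) → ℕ) (h0 : m 0 = d)
    (hL : m (Fin.last L) = k) (ℓ : Fin (L + 1)) (u : Fin (m ℓ)) :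
    Continuous fun p : Weights L m × (Fin d → ℝ) =>
      (ofWeights m h0 hL p.1).preact φ p.2 ℓ u := by
  induction ℓ using Fin.induction with
  | zero =>
    change Continuous fun p : Weights L m × (Fin d → ℝ) => p.2 (Fin.cast h0 u)
    fun_prop
  | succ ℓ ih =>
    have h : Continuous fun p : Weights L m × (Fin d → ℝ) => ∑ v : Fin (m ℓ.castSucc),
        p.1 ℓ u v * actAt φ ℓ.val ((ofWeights m h0 hL p.1).preact φ p.2 ℓ.castSucc v) :=
      continuous_finsetSum _ fun v _ =>
        Continuous.mul (by fun_prop) ((hφ.continuous_actAt _).comp (ih v))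
    exact h.congr fun p => ((ofWeights m h0 hL p.1).preact_succ φ p.2 ℓ u).symm

lemma continuous_eval_ofWeights (hφ : IsActivation φ) (m : Fin (L + 1) → ℕ) (h0 : m 0 = d)
    (hL : m (Fin.last L) = k) :
    Continuous fun p : Weights L m × (Fin d → ℝ) => (ofWeights m h0 hL p.1).eval φ p.2 :=
  continuous_pi fun c =>
    continuous_preact_ofWeights hφ m h0 hL (Fin.last L) (Fin.cast hL.symm c)

lemma continuous_eval (N : Net d k L) (hφ : IsActivation φ) : Continuous (N.eval φ) :=
  (continuous_eval_ofWeights hφ N.width N.width_zero N.width_last).comp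
    (Continuous.prodMk_right (fun ℓ => N.W ℓ))

/-- The ramp loss at margin `γ`, restricted to the inputs of norm at most `r`. -/
def truncLoss (p : ℝ≥0∞) (r : ℝ) (φ : ℝ → ℝ) (N : Net d k L) (γ : ℝ)
    (z : (Fin d → ℝ) × Fin k) : ℝ :=
  open scoped Classical in
  if vecNorm p z.1 ≤ r then ramp (margin (fun c => N.eval φ z.1 c / γ) z.2) else 0

variable {p : ℝ≥0∞} {r : ℝ}

lemma truncLoss_nonneg (N : Net d k L) (γ : ℝ) (z : (Fin d → ℝ) × Fin k) :
    0 ≤ truncLoss p r φ N γ z := by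
  unfold truncLoss; split_ifs; exacts [ramp_nonneg _, le_rfl]

lemma truncLoss_le_one (N : Net d k L) (γ : ℝ) (z : (Fin d → ℝ) × Fin k) :
    truncLoss p r φ N γ z ≤ 1 := by
  unfold truncLoss; split_ifs; exacts [ramp_le_one _, zero_le_one]

lemma measurable_truncLoss [Fact (1 ≤ p)] (hk : 2 ≤ k) (hφ : IsActivation φ) (N : Net d k L)
    (γ : ℝ) : Measurable (truncLoss p r φ N γ) := by
  refine Measurable.ite (measurableSet_le
    ((continuous_vecNorm p).measurable.comp measurable_fst) measurable_const) ?_ measurable_const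
  refine measurable_from_prod_countable_left fun y => ?_
  have h : Continuous fun x : Fin d → ℝ => fun c => N.eval φ x c / γ :=
    continuous_pi fun c => ((continuous_apply c).comp (N.continuous_eval hφ)).div_const γ
  exact (continuous_ramp.comp ((continuous_margin hk y).comp h)).measurable

/-- The networks and margins whose scores, divided by the margin, have absolute sum at most `b` on
the inputs of norm at most `r`. -/
def Admissible (p : ℝ≥0∞) (r b : ℝ) (N : Net d k L) (γ : ℝ) : Prop :=
  0 < γ ∧ ∀ x : Fin d → ℝ, vecNorm p x ≤ r → ∑ c, ∑ j, N.absProd c j * |x j| ≤ b * γ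

/-- The Rademacher averages of the truncated losses of admissible networks. -/
lemma expect_iSup_truncLoss_le {ι : Type*} [Finite ι] [Nonempty ι] (hk : 2 ≤ k) (hn : 1 ≤ n)
    (hφ : IsActivation φ) [Fact (1 ≤ p)] (hp : 2 ≤ p) (hr : 0 ≤ r) {b Λ : ℝ} (hb : 0 < b)
    (hΛ : 0 < Λ) (hE : ((n : ℝ) + n ^ 2 + 1) * (2 ^ L * (2 * (d + 1))) ≤ Real.exp Λ)
    (F : ι → Net d k L) (γ : ι → ℝ) (h : ∀ a, (F a).Admissible p r b (γ a))
    (z : Fin n → (Fin d → ℝ) × Fin k) :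
    𝔼 σ : Fin n → Bool, (⨆ a, ∑ i, sgn (σ i) * truncLoss p r φ (F a) (γ a) (z i))
      ≤ 2 * b * Real.sqrt (2 * n * Λ) + b := by
  classical
  set X : Fin n → Fin d → ℝ := fun i => if vecNorm p (z i).1 ≤ r then (z i).1 else 0 with hX
  have hXr : ∀ i, vecNorm p (X i) ≤ r := by
    intro i
    by_cases h : vecNorm p (z i).1 ≤ r
    · simp [hX, h]
    · simp [hX, h, vecNorm_zero, hr]
  refine expect_iSup_ramp_margin_le hk hn hφ F γ (fun a => (h a).1) X (fun i => (z i).2) hb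
    (fun a => ?_) (fun a i => (h a).2 _ (hXr i)) hΛ hE _ fun i => ?_
  -- The vector of root mean squares itself has norm at most `r`, so admissibility applies to it as
  -- if it were an input.
  · have := (h a).2 _ (vecNorm_rms_le hn hp hr hXr)
    simpa only [abs_of_nonneg (rms_nonneg X _)] using this
  · by_cases hi : vecNorm p (z i).1 ≤ r
    · exact Or.inr fun a => by simp [truncLoss, hX, hi]
    · exact Or.inl fun a => by simp [truncLoss, hi]

/-- Uniform deviation inequality for the truncated losses of all admissible networks. -/
lemma measure_admissible_deviation_le (hk : 2 ≤ k) (hn : 1 ≤ n)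
    (hφ : IsActivation φ) [Fact (1 ≤ p)] (hp : 2 ≤ p) (hr : 0 ≤ r) {b Λ : ℝ} (hb : 0 < b)
    (hΛ : 0 < Λ) (hE : ((n : ℝ) + n ^ 2 + 1) * (2 ^ L * (2 * (d + 1))) ≤ Real.exp Λ)
    (D : Measure ((Fin d → ℝ) × Fin k)) [IsProbabilityMeasure D] {u : ℝ} (hu : 0 ≤ u) :
    (Measure.pi fun _ : Fin n => D) {S | ∃ (N : Net d k L) (γ : ℝ), N.Admissible p r b γ ∧
        2 * (2 * b * Real.sqrt (2 * n * Λ) + b) / n + Real.sqrt (2 * u / n)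
        < ∫ z, truncLoss p r φ N γ z ∂D - (1 / (n : ℝ)) * ∑ i, truncLoss p r φ N γ (S i)}
      ≤ ENNReal.ofReal (Real.exp (-u)) := by
  set ε := 2 * (2 * b * Real.sqrt (2 * n * Λ) + b) / n + Real.sqrt (2 * u / n) with hε
  set G : Net d k L → ℝ → (Fin n → (Fin d → ℝ) × Fin k) → ℝ := fun N γ S =>
    ∫ z, truncLoss p r φ N γ z ∂D - (1 / (n : ℝ)) * ∑ i, truncLoss p r φ N γ (S i) with hG
  let Wd := {m : Fin (L + 1) → ℕ // m 0 = d ∧ m (Fin.last L) = k}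
  let Θ : Wd → Type := fun m => {w : Weights L m.1 × ℝ //
    (ofWeights m.1 m.2.1 m.2.2 w.1).Admissible p r b w.2}
  let net : ∀ m : Wd, Θ m → Net d k L := fun m w => ofWeights m.1 m.2.1 m.2.2 w.1.1
  have hcont : ∀ (m : Wd) z, Continuous fun w : Θ m => truncLoss p r φ (net m w) w.1.2 z := by
    intro m z
    unfold truncLoss
    split_ifs
    · have h : Continuous fun w : Θ m => fun c => (net m w).eval φ z.1 c / w.1.2 := by
        refine continuous_pi fun c => Continuous.div ?_
          (continuous_snd.comp continuous_subtype_val) fun w => w.2.1.ne'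
        exact ((continuous_apply c).comp (continuous_eval_ofWeights hφ m.1 m.2.1 m.2.2)).comp
          ((continuous_fst.comp continuous_subtype_val).prodMk continuous_const)
      exact continuous_ramp.comp ((continuous_margin hk z.2).comp h)
    · exact continuous_const
  have hGcont : ∀ (m : Wd) S, Continuous fun w : Θ m => G (net m w) w.1.2 S := by
    intro m S
    refine Continuous.sub ?_ (continuous_const.mul (continuous_finsetSum _ fun i _ => hcont m _))
    refine continuous_of_dominated (bound := fun _ => 1)
      (fun w => (measurable_truncLoss hk hφ _ _).aestronglyMeasurable)
      (fun w => ae_of_all _ fun z => ?_) (integrable_const _) (ae_of_all _ fun z => hcont m z)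
    rw [Real.norm_eq_abs, abs_of_nonneg (truncLoss_nonneg _ _ _)]
    exact truncLoss_le_one _ _ _
  -- There are countably many width vectors, and for each one a countable dense set of admissible
  -- parameters. The deviation is continuous in the parameters and its violation is a strict
  -- inequality, so a violating network has a violating neighbour in `Q`.
  choose Q hQc hQd using fun m : Wd => TopologicalSpace.exists_countable_dense (Θ m)
  have : ∀ m, Countable (Q m) := fun m => (hQc m).to_subtype
  let A : (Σ m : Wd, Q m) → Set (Fin n → (Fin d → ℝ) × Fin k) :=
    fun j => {S | ε < G (net j.1 j.2) j.2.1.1.2 S}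
  refine le_trans (measure_mono (t := ⋃ j, A j) ?_) (measure_iUnion_le_of_finset _ A fun T => ?_)
  · rintro S ⟨N, γ, hN, hlt⟩
    let m : Wd := ⟨N.width, N.width_zero, N.width_last⟩
    obtain ⟨w, hw, hwQ⟩ := (hQd m).exists_mem_open
      ((isOpen_Ioi (a := ε)).preimage (hGcont m S)) ⟨⟨(fun ℓ => N.W ℓ, γ), hN⟩, hlt⟩
    exact Set.mem_iUnion.2 ⟨⟨m, w, hw⟩, hwQ⟩
  · rcases T.eq_empty_or_nonempty with rfl | hT
    · simp
    · have : Nonempty T := hT.to_subtype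
      refine le_trans (measure_mono ?_) (measure_uniform_deviation_le hn D
        (fun (j : T) => truncLoss p r φ (net j.1.1 j.1.2) j.1.2.1.1.2)
        (fun j => measurable_truncLoss hk hφ _ _) (fun j => truncLoss_nonneg _ _)
        (fun j => truncLoss_le_one _ _)
        (expect_iSup_truncLoss_le hk hn hφ hp hr hb hΛ hE (fun j : T => net j.1.1 j.1.2)
          (fun j => j.1.2.1.1.2) fun j => j.1.2.1.2) hu)
      intro S hS
      obtain ⟨j, hj, hS⟩ := Set.mem_iUnion₂.1 hS
      exact ⟨⟨j, hj⟩, hS⟩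

end Net

/-! ### Norms of the product matrix -/

lemma two_le_conjExponent {q : ℝ≥0∞} (hq : q ≤ 2) : 2 ≤ q.conjExponent := by
  rw [ENNReal.conjExponent, ← one_add_one_eq_two]
  gcongr
  rw [ENNReal.one_le_inv, tsub_le_iff_right, one_add_one_eq_two]
  exact hq

lemma sum_abs_mul_abs_le {ι : Type*} [Fintype ι] {q : ℝ≥0∞} (h1 : 1 ≤ q) (h2 : q ≤ 2)
    (a x : ι → ℝ) : ∑ j, |a j| * |x j| ≤ vecNorm q a * vecNorm q.conjExponent x := by
  have hqt : q ≠ ∞ := ne_top_of_le_ne_top ENNReal.ofNat_ne_top h2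
  have : Fact (1 ≤ q) := ⟨h1⟩
  rcases h1.eq_or_lt with rfl | h1
  · have hc : (1 : ℝ≥0∞).conjExponent = ∞ := by simp [ENNReal.conjExponent]
    rw [hc, vecNorm_eq_sum (by simp)]
    simp only [ENNReal.toReal_one, div_one, Real.rpow_one]
    rw [Finset.sum_mul]
    have hx := (vecNorm_top_le_iff (v := x) (vecNorm_nonneg ∞ x)).1 le_rfl
    exact Finset.sum_le_sum fun j _ => mul_le_mul_of_nonneg_left (hx j) (abs_nonneg _)
  · have hq1 : 1 < q.toReal := by
      rw [← ENNReal.toReal_one]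
      exact (ENNReal.toReal_lt_toReal ENNReal.one_ne_top hqt).2 h1
    have hconj := ENNReal.HolderConjugate.toReal (p := q) (q := q.conjExponent) hq1
    rw [vecNorm_eq_sum hconj.pos, vecNorm_eq_sum hconj.symm.pos]
    have := Real.inner_le_Lp_mul_Lq Finset.univ (fun j => |a j|) (fun j => |x j|) hconj
    simpa only [abs_abs] using this

lemma mixedNorm_nonneg {ι κ : Type*} [Fintype ι] [Fintype κ] (p : ℝ≥0∞) [Fact (1 ≤ p)]
    (A : Matrix ι κ ℝ) : 0 ≤ mixedNorm p A :=
  Finset.sum_nonneg fun _ _ => vecNorm_nonneg p _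

lemma inducedNorm_nonneg {ι κ : Type*} [Fintype ι] [Fintype κ] (p : ℝ≥0∞) [Fact (1 ≤ p)]
    (A : Matrix ι κ ℝ) : 0 ≤ inducedNorm p A :=
  Real.iSup_nonneg fun _ => div_nonneg (vecNorm_nonneg p _) (vecNorm_nonneg p _)

/-- The operator norm on `WithLp` bounds the quotients, so the real supremum in `inducedNorm` is a
genuine one. -/
lemma vecNorm_mulVec_le {ι κ : Type*} [Fintype ι] [Fintype κ] (p : ℝ≥0∞) [Fact (1 ≤ p)]
    (A : Matrix ι κ ℝ) (z : κ → ℝ) : vecNorm p (A *ᵥ z) ≤ inducedNorm p A * vecNorm p z := by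
  classical
  let T := LinearMap.toContinuousLinearMap (Matrix.toLpLin p p A)
  have hT : ∀ z, vecNorm p (A *ᵥ z) ≤ ‖T‖ * vecNorm p z := fun z => T.le_opNorm (WithLp.toLp p z)
  have hbdd : BddAbove (Set.range fun z : κ → ℝ => vecNorm p (A *ᵥ z) / vecNorm p z) := by
    refine ⟨‖T‖, ?_⟩
    rintro _ ⟨z, rfl⟩
    exact div_le_of_le_mul₀ (vecNorm_nonneg p z) (norm_nonneg _) (hT z)
  rcases (vecNorm_nonneg p z).eq_or_lt with h | h
  · have := hT z
    rw [← h, mul_zero] at this ⊢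
    exact this
  · exact (div_le_iff₀ h).1 (le_ciSup hbdd z)

namespace Net

variable {d k L n : ℕ} (N : Net d k L)

lemma sum_absProd_le_mixedNorm {q : ℝ≥0∞} (h1 : 1 ≤ q) (h2 : q ≤ 2) (x : Fin d → ℝ) :
    ∑ c, ∑ j, N.absProd c j * |x j| ≤ mixedNorm q N.absProd * vecNorm q.conjExponent x := by
  rw [mixedNorm, Finset.sum_mul]
  refine Finset.sum_le_sum fun c _ => le_trans (le_of_eq ?_) (sum_abs_mul_abs_le h1 h2 _ x)
  exact Finset.sum_congr rfl fun j _ => by rw [abs_of_nonneg (N.absProd_nonneg c j)]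

/-- Hölder against the all-ones vector: the sum over the outputs costs `k ^ (1 / q) = k ^ (1 - 1 /
q*)` times the `q*` norm of the image vector. -/
lemma sum_absProd_le_inducedNorm {q : ℝ≥0∞} (h1 : 1 ≤ q) (h2 : q ≤ 2) (x : Fin d → ℝ) :
    ∑ c, ∑ j, N.absProd c j * |x j| ≤ (k : ℝ) ^ (1 - 1 / q.conjExponent.toReal) *
      inducedNorm q.conjExponent N.absProd * vecNorm q.conjExponent x := by
  have : Fact (1 ≤ q.conjExponent) := ⟨one_le_two.trans (two_le_conjExponent h2)⟩
  have hqt : q ≠ ∞ := ne_top_of_le_ne_top ENNReal.ofNat_ne_top h2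
  have hq0 : 0 < q.toReal := ENNReal.toReal_pos (one_pos.trans_le h1).ne' hqt
  have habs : vecNorm q.conjExponent (fun j => |x j|) = vecNorm q.conjExponent x := by
    rcases eq_or_ne q.conjExponent ∞ with h | h
    · rw [h]
      refine le_antisymm ?_ ?_
      · rw [vecNorm_top_le_iff (vecNorm_nonneg ∞ x)]
        simpa only [abs_abs] using (vecNorm_top_le_iff (vecNorm_nonneg ∞ x)).1 le_rfl
      · rw [vecNorm_top_le_iff (vecNorm_nonneg ∞ _)]
        simpa only [abs_abs] using
          (vecNorm_top_le_iff (v := fun j => |x j|) (vecNorm_nonneg ∞ _)).1 le_rfl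
    · have hc0 : 0 < q.conjExponent.toReal := ENNReal.toReal_pos
        (two_pos.trans_le (two_le_conjExponent h2)).ne' h
      simp only [vecNorm_eq_sum hc0, abs_abs]
  have hone : vecNorm q (fun _ : Fin k => (1 : ℝ)) = (k : ℝ) ^ (1 - 1 / q.conjExponent.toReal) := by
    rw [vecNorm_eq_sum hq0]
    simp only [abs_one, Real.one_rpow, Finset.sum_const, Finset.card_univ, Fintype.card_fin,
      nsmul_eq_mul, mul_one]
    congr 1
    rcases h1.eq_or_lt with rfl | h1
    -- Here `q* = ∞` has `toReal` equal to `0`, so `1 / 0 = 0` gives the intended exponent `1`.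
    · simp [ENNReal.conjExponent]
    · have hq1 : 1 < q.toReal := by
        rw [← ENNReal.toReal_one]
        exact (ENNReal.toReal_lt_toReal ENNReal.one_ne_top hqt).2 h1
      have : Fact (1 ≤ q) := ⟨h1.le⟩
      have hconj := ENNReal.HolderConjugate.toReal (p := q) (q := q.conjExponent) hq1
      rw [one_div, one_div, ← hconj.symm.one_sub_inv]
  have hA : ∀ c, ∑ j, N.absProd c j * |x j| = (N.absProd *ᵥ fun j => |x j|) c := fun c => rfl
  have hA0 : ∀ c, 0 ≤ (N.absProd *ᵥ fun j => |x j|) c := fun c => by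
    rw [← hA]
    exact Finset.sum_nonneg fun j _ => mul_nonneg (N.absProd_nonneg c j) (abs_nonneg _)
  have h := sum_abs_mul_abs_le h1 h2 (fun _ : Fin k => (1 : ℝ)) (N.absProd *ᵥ fun j => |x j|)
  simp only [abs_one, one_mul, abs_of_nonneg (hA0 _), hone] at h
  simp only [hA]
  rw [mul_assoc, ← habs]
  exact h.trans (mul_le_mul_of_nonneg_left (vecNorm_mulVec_le _ _ _)
    (Real.rpow_nonneg (Nat.cast_nonneg k) _))

/-! ### The path complexity is at least `1` -/

lemma inputWeight_nonneg (q : ℝ≥0∞) (X : Fin n → Fin d → ℝ) (j : Fin d) :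
    0 ≤ inputWeight q X j := by
  unfold inputWeight
  split_ifs
  · exact Real.iSup_nonneg fun i => abs_nonneg _
  · exact Real.rpow_nonneg (div_nonneg (Finset.sum_nonneg fun i _ =>
      Real.rpow_nonneg (abs_nonneg _) _) (Nat.cast_nonneg n)) _

lemma pathDist_nonneg (q : ℝ≥0∞) (X : Fin n → Fin d → ℝ) (j : N.Path) : 0 ≤ N.pathDist q X j := by
  have h : ∀ j, 0 ≤ N.dataPathWeight q X j := fun j =>
    mul_nonneg (inputWeight_nonneg q X _) (Finset.prod_nonneg fun _ _ => abs_nonneg _)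
  exact div_nonneg (h j) (Finset.sum_nonneg fun j _ => h j)

lemma pathMarginal_nonneg (q : ℝ≥0∞) (X : Fin n → Fin d → ℝ) (ℓ : Fin (L + 1))
    (i : Fin (N.width ℓ)) : 0 ≤ N.pathMarginal q X ℓ i :=
  Finset.sum_nonneg fun j _ => by
    split_ifs
    exacts [N.pathDist_nonneg q X j, le_rfl]

lemma sum_pathMarginal (q : ℝ≥0∞) (X : Fin n → Fin d → ℝ) (ℓ : Fin (L + 1)) :
    ∑ i, N.pathMarginal q X ℓ i = N.pathVariation q X / N.pathVariation q X := by
  unfold pathMarginal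
  rw [Finset.sum_comm]
  simp only [Finset.sum_ite_eq, Finset.mem_univ, if_true]
  unfold pathDist
  rw [← Finset.sum_div]
  rfl

/-- Since `√p ≥ p` on `[0, 1]`, the square roots of a probability vector sum to at least `1`. For
the zero vector, `Real.log 0 = 0` again gives the value `1`. -/
lemma one_le_exp_renyiEntropy (q : ℝ≥0∞) (X : Fin n → Fin d → ℝ) (ℓ : Fin (L + 1)) :
    1 ≤ Real.exp ((1 / 2) * renyiEntropy (1 / 2) (N.pathMarginal q X ℓ)) := by
  rw [Real.one_le_exp_iff, renyiEntropy]
  have hs := N.sum_pathMarginal q X ℓ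
  have h0 := N.pathMarginal_nonneg q X ℓ
  refine mul_nonneg (by norm_num) (mul_nonneg (by norm_num) ?_)
  by_cases hV : N.pathVariation q X = 0
  · rw [hV, div_zero, Finset.sum_eq_zero_iff_of_nonneg fun i _ => h0 i] at hs
    rw [Finset.sum_eq_zero fun i hi => by rw [hs i hi, Real.zero_rpow (by norm_num)]]
    simp
  · rw [div_self hV] at hs
    refine Real.log_nonneg (hs.symm.le.trans (Finset.sum_le_sum fun i hi => ?_))
    have h1 : N.pathMarginal q X ℓ i ≤ 1 :=
      hs ▸ Finset.single_le_sum (f := N.pathMarginal q X ℓ) (fun i _ => h0 i) hi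
    simpa using Real.rpow_le_rpow_of_exponent_ge_of_imp (h0 i) h1
      (by norm_num : (1 / 2 : ℝ) ≤ 1) (fun _ h => absurd h (by norm_num))

lemma one_le_pathComplexity (hL : 1 ≤ L) (q : ℝ≥0∞) (X : Fin n → Fin d → ℝ) :
    1 ≤ N.pathComplexity q X := by
  have hL0 : (0 : ℝ) < L := by exact_mod_cast hL
  unfold pathComplexity
  rw [one_div, ← div_eq_inv_mul, one_le_div hL0]
  have hcard : ((L : ℝ) - 1) = ∑ ℓ : Fin (L + 1), if ℓ ≠ 0 ∧ ℓ ≠ Fin.last L then (1 : ℝ) else 0 := by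
    obtain ⟨L, rfl⟩ : ∃ L', L = L' + 1 := ⟨L - 1, by omega⟩
    rw [Fin.sum_univ_succ, Fin.sum_univ_castSucc]
    have h1 : ∀ i : Fin L, ((i.castSucc.succ : Fin (L + 2)) ≠ 0 ∧
        i.castSucc.succ ≠ Fin.last (L + 1)) := fun i => by
      have := i.2
      simp only [ne_eq, Fin.ext_iff, Fin.val_succ, Fin.val_castSucc, Fin.val_zero, Fin.val_last]
      omega
    rw [Finset.sum_congr rfl fun i _ => if_pos (h1 i)]
    simp
  have hle : ((L : ℝ) - 1) ≤ ∑ ℓ : Fin (L + 1), if ℓ ≠ 0 ∧ ℓ ≠ Fin.last L then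
      Real.exp ((1 / 2) * renyiEntropy (1 / 2) (N.pathMarginal q X ℓ)) else 0 := by
    rw [hcard]
    refine Finset.sum_le_sum fun ℓ _ => ?_
    split_ifs
    exacts [N.one_le_exp_renyiEntropy q X ℓ, le_rfl]
  linarith

end Net

/-! ### Margin losses -/

lemma margin_div {k : ℕ} (v : Fin k → ℝ) (y : Fin k) {γ : ℝ} (hγ : 0 < γ) :
    margin (fun c => v c / γ) y = margin v y / γ := by
  unfold margin
  simp only [div_eq_mul_inv]
  rw [← Real.iSup_mul_of_nonneg (inv_nonneg.2 hγ.le)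
    (fun j : {j : Fin k // j ≠ y} => v j), sub_mul]

lemma margin_le_sum_abs {k : ℕ} (hk : 2 ≤ k) (v : Fin k → ℝ) (y : Fin k) :
    margin v y ≤ ∑ c, |v c| := by
  have : Nontrivial (Fin k) := Fin.nontrivial_iff_two_le.2 hk
  obtain ⟨j, hj⟩ := exists_ne y
  have h1 := le_iSup_of_finite (fun j : {j : Fin k // j ≠ y} => v j) ⟨j, hj⟩
  have h2 := Finset.add_le_sum (f := fun c => |v c|) (fun c _ => abs_nonneg _)
    (Finset.mem_univ y) (Finset.mem_univ j) hj.symm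
  simp only at h1 h2
  unfold margin
  linarith [le_abs_self (v y), neg_le_abs (v j)]

lemma marginLoss_nonneg {d k : ℕ} (γ : ℝ) (f : (Fin d → ℝ) → Fin k → ℝ)
    (z : (Fin d → ℝ) × Fin k) : 0 ≤ marginLoss γ f z := by
  unfold marginLoss; split_ifs <;> norm_num

lemma marginLoss_le_one {d k : ℕ} (γ : ℝ) (f : (Fin d → ℝ) → Fin k → ℝ)
    (z : (Fin d → ℝ) × Fin k) : marginLoss γ f z ≤ 1 := by
  unfold marginLoss; split_ifs <;> norm_num

lemma popLoss_le_one {d k : ℕ} (D : Measure ((Fin d → ℝ) × Fin k)) [IsProbabilityMeasure D]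
    (f : (Fin d → ℝ) → Fin k → ℝ) : popLoss D f ≤ 1 := by
  have : popLoss D f ≤ ∫ _z, (1 : ℝ) ∂D := integral_mono_of_nonneg
    (ae_of_all _ fun z => marginLoss_nonneg 0 f z) (integrable_const _)
    (ae_of_all _ fun z => marginLoss_le_one 0 f z)
  simpa using this

namespace Net

variable {d k L n : ℕ} {φ : ℝ → ℝ} (N : Net d k L)

/-- Inside the ball the ramp dominates the classification loss; outside it the loss is at most `1`.
-/
lemma popLoss_le_truncLoss {p : ℝ≥0∞} [Fact (1 ≤ p)] {r : ℝ} (hk : 2 ≤ k) (hφ : IsActivation φ)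
    (D : Measure ((Fin d → ℝ) × Fin k)) [IsProbabilityMeasure D] {γ : ℝ} (hγ : 0 < γ) :
    popLoss D (N.eval φ) ≤ ∫ z, truncLoss p r φ N γ z ∂D + D.real {z | r < vecNorm p z.1} := by
  have hms : MeasurableSet {z : (Fin d → ℝ) × Fin k | r < vecNorm p z.1} :=
    measurableSet_lt measurable_const ((continuous_vecNorm p).measurable.comp measurable_fst)
  have hti : Integrable (truncLoss p r φ N γ) D :=
    Integrable.of_bound (measurable_truncLoss hk hφ N γ).aestronglyMeasurable 1
      (ae_of_all _ fun z => by
        rw [Real.norm_eq_abs, abs_of_nonneg (truncLoss_nonneg N γ z)]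
        exact truncLoss_le_one N γ z)
  have hii : Integrable ({z : (Fin d → ℝ) × Fin k | r < vecNorm p z.1}.indicator
      fun _ => (1 : ℝ)) D := (integrable_const 1).indicator hms
  rw [← integral_indicator_one hms]
  change _ ≤ _ + ∫ z, ({z : (Fin d → ℝ) × Fin k | r < vecNorm p z.1}.indicator
    fun _ => (1 : ℝ)) z ∂D
  rw [← integral_add hti hii]
  refine integral_mono_of_nonneg (ae_of_all _ fun z => marginLoss_nonneg 0 _ z) (hti.add hii)
    (ae_of_all _ fun z => ?_)
  by_cases hz : r < vecNorm p z.1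
  · have : ({z : (Fin d → ℝ) × Fin k | r < vecNorm p z.1}.indicator (fun _ => (1 : ℝ))) z = 1 := by
      simp [Set.indicator, hz]
    simp only [this]
    linarith [marginLoss_le_one 0 (N.eval φ) z, truncLoss_nonneg (p := p) (r := r) (φ := φ) N γ z]
  · have h1 : 0 ≤ ({z : (Fin d → ℝ) × Fin k | r < vecNorm p z.1}.indicator
        (fun _ => (1 : ℝ))) z := Set.indicator_nonneg (fun _ _ => zero_le_one) z
    refine le_add_of_le_of_nonneg ?_ h1
    unfold marginLoss truncLoss
    rw [if_pos (not_lt.1 hz), margin_div _ _ hγ]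
    split_ifs with hm
    · have : margin (N.eval φ z.1) z.2 / γ ≤ 0 := div_nonpos_of_nonpos_of_nonneg hm hγ.le
      exact le_max_of_le_right (le_min le_rfl (by linarith))
    · exact ramp_nonneg _

lemma truncLoss_le_marginLoss {p : ℝ≥0∞} {r γ : ℝ} (hγ : 0 < γ) (z : (Fin d → ℝ) × Fin k) :
    truncLoss p r φ N γ z ≤ marginLoss γ (N.eval φ) z := by
  unfold truncLoss marginLoss
  rw [margin_div _ _ hγ]
  by_cases hm : margin (N.eval φ z.1) z.2 ≤ γ
  · rw [if_pos hm]
    split_ifs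
    exacts [ramp_le_one _, zero_le_one]
  · rw [if_neg hm]
    split_ifs
    · have : 1 < margin (N.eval φ z.1) z.2 / γ := (one_lt_div hγ).2 (not_le.1 hm)
      exact max_le le_rfl ((min_le_right _ _).trans (by linarith))
    · exact le_rfl

end Net

/-! ### A high quantile of the input norm -/

/-- Take the infimum of the nonnegative levels whose tail is at most `τ`. Approaching it from above
gives the first bound, from below the second; both limits are increasing unions. -/
lemma exists_quantile {Z : Type*} [MeasurableSpace Z] (D : Measure Z) [IsProbabilityMeasure D]
    {h : Z → ℝ} (hm : Measurable h) (h0 : ∀ z, 0 ≤ h z) {τ : ℝ≥0∞} (hτ : 0 < τ) :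
    ∃ r, 0 ≤ r ∧ D {z | r < h z} ≤ τ ∧ D {z | h z < r} ≤ 1 - τ := by
  set A : Set ℝ := {s | 0 ≤ s ∧ D {z | s < h z} ≤ τ} with hA
  have hms : ∀ s, MeasurableSet {z | s < h z} := fun s => measurableSet_lt measurable_const hm
  have hbdd : BddBelow A := ⟨0, fun s hs => hs.1⟩
  have hne : A.Nonempty := by
    have hanti : Antitone fun m : ℕ => {z | (m : ℝ) < h z} := fun a b hab z hz =>
      lt_of_le_of_lt (Nat.cast_le.2 hab) (show (b : ℝ) < h z from hz)
    have h1 := hanti.measure_iInter (μ := D) (fun m => (hms m).nullMeasurableSet)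
      ⟨0, measure_ne_top _ _⟩
    have h2 : (⋂ m : ℕ, {z | (m : ℝ) < h z}) = ∅ := by
      ext z
      simp only [Set.mem_iInter, Set.mem_ofPred_eq, Set.mem_empty_iff_false, iff_false, not_forall,
        not_lt]
      exact exists_nat_ge (h z)
    rw [h2, measure_empty] at h1
    obtain ⟨m, hlt⟩ := iInf_lt_iff.1 (h1 ▸ hτ)
    exact ⟨m, Nat.cast_nonneg m, hlt.le⟩
  set r := sInf A with hr
  have hr0 : 0 ≤ r := le_csInf hne fun s hs => hs.1
  refine ⟨r, hr0, ?_, ?_⟩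
  · have hmono : Monotone fun m : ℕ => {z | r + 1 / ((m : ℝ) + 1) < h z} := fun a b hab z hz =>
      lt_of_le_of_lt (add_le_add_right (Nat.one_div_le_one_div hab) r) hz
    have hU : {z | r < h z} = ⋃ m : ℕ, {z | r + 1 / ((m : ℝ) + 1) < h z} := by
      ext z
      simp only [Set.mem_iUnion, Set.mem_ofPred_eq]
      refine ⟨fun hz => ?_, fun ⟨m, hz⟩ => lt_trans (lt_add_of_pos_right r (by positivity)) hz⟩
      obtain ⟨m, hlt⟩ := exists_nat_one_div_lt (sub_pos.2 hz)
      exact ⟨m, by linarith⟩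
    rw [hU, hmono.measure_iUnion]
    refine iSup_le fun m => ?_
    obtain ⟨s, hs, hlt⟩ := exists_lt_of_csInf_lt hne
      (lt_add_of_pos_right r (by positivity : (0 : ℝ) < 1 / ((m : ℝ) + 1)))
    exact (measure_mono fun z (hz : _ < h z) => hlt.trans hz).trans hs.2
  · have hmono : Monotone fun m : ℕ => {z | h z ≤ r - 1 / ((m : ℝ) + 1)} := fun a b hab z hz =>
      le_trans (show h z ≤ r - 1 / ((a : ℝ) + 1) from hz)
        (sub_le_sub_left (Nat.one_div_le_one_div hab) r)
    have hU : {z | h z < r} = ⋃ m : ℕ, {z | h z ≤ r - 1 / ((m : ℝ) + 1)} := by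
      ext z
      simp only [Set.mem_iUnion, Set.mem_ofPred_eq]
      refine ⟨fun hz => ?_, fun ⟨m, hz⟩ => lt_of_le_of_lt hz (sub_lt_self r (by positivity))⟩
      obtain ⟨m, hlt⟩ := exists_nat_one_div_lt (sub_pos.2 hz)
      exact ⟨m, by linarith⟩
    rw [hU, hmono.measure_iUnion]
    refine iSup_le fun m => ?_
    set s := r - 1 / ((m : ℝ) + 1) with hs
    have hsr : s < r := sub_lt_self r (by positivity)
    rcases lt_or_ge s 0 with hs0 | hs0
    · have : {z | h z ≤ s} = ∅ := by
        ext z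
        simp only [Set.mem_ofPred_eq, Set.mem_empty_iff_false, iff_false, not_le]
        exact hs0.trans_le (h0 z)
      rw [this, measure_empty]
      exact zero_le
    · have hlt : τ < D {z | s < h z} := by
        by_contra hle
        exact absurd (csInf_le hbdd ⟨hs0, not_lt.1 hle⟩) (not_le.2 hsr)
      have hc : {z | h z ≤ s} = {z | s < h z}ᶜ := by ext z; simp
      rw [hc, measure_compl (hms s) (measure_ne_top _ _), measure_univ]
      exact tsub_le_tsub_left hlt.le 1

/-- Independence and `(1 - t / n) ^ n ≤ exp (-t)`. If `t > n`, both sides of the `ENNReal`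
conversion clip to `0`. -/
lemma measure_pi_forall_lt_le {Z : Type*} [MeasurableSpace Z] {n : ℕ} (hn : 1 ≤ n) (D : Measure Z)
    [IsProbabilityMeasure D] (h : Z → ℝ) {r t : ℝ} (ht : 0 ≤ t)
    (hr : D {z | h z < r} ≤ 1 - ENNReal.ofReal (t / n)) :
    (Measure.pi fun _ : Fin n => D) {S | ∀ i, h (S i) < r} ≤ ENNReal.ofReal (Real.exp (-t)) := by
  have hn0 : (0 : ℝ) < n := by exact_mod_cast hn
  have hset : {S : Fin n → Z | ∀ i, h (S i) < r} = Set.univ.pi fun _ => {z | h z < r} := by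
    ext S; simp
  rw [hset, Measure.pi_pi, Finset.prod_const, Finset.card_univ, Fintype.card_fin]
  have h1 : D {z | h z < r} ≤ ENNReal.ofReal (Real.exp (-(t / n))) := by
    refine hr.trans ?_
    rw [← ENNReal.ofReal_one, ← ENNReal.ofReal_sub _ (by positivity)]
    refine ENNReal.ofReal_le_ofReal ?_
    linarith [Real.add_one_le_exp (-(t / n))]
  refine (pow_le_pow_left₀ zero_le h1 n).trans (le_of_eq ?_)
  rw [← ENNReal.ofReal_pow (Real.exp_pos _).le, ← Real.exp_nat_mul]
  congr 2
  field_simp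

/-! ### The generalization bound -/

lemma le_maxNorm {d n : ℕ} (p : ℝ≥0∞) (X : Fin n → Fin d → ℝ) (i : Fin n) :
    vecNorm p (X i) ≤ maxNorm p X :=
  le_iSup_of_finite (fun i => vecNorm p (X i)) i

lemma maxNorm_nonneg {d n : ℕ} (p : ℝ≥0∞) [Fact (1 ≤ p)] (X : Fin n → Fin d → ℝ) :
    0 ≤ maxNorm p X := Real.iSup_nonneg fun _ => vecNorm_nonneg p _

/-- The left side is the slot count times the exponential moment constant after `L` layers; this
fixes the value of `Λ`. The numerical factors `3` and `4` are absorbed by `12 ≤ exp 3`. -/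
lemma le_exp_of_log_bounds {d L n : ℕ} (hd : 1 ≤ d) (hL : 1 ≤ L) (hn : 1 ≤ n) :
    ((n : ℝ) + n ^ 2 + 1) * (2 ^ L * (2 * (d + 1)))
      ≤ Real.exp (4 * ((1 + Real.log n) * (L + Real.log d))) := by
  have hn1 : (1 : ℝ) ≤ n := by exact_mod_cast hn
  have hd1 : (1 : ℝ) ≤ d := by exact_mod_cast hd
  have hL1 : (1 : ℝ) ≤ L := by exact_mod_cast hL
  have hln := Real.log_nonneg hn1
  have hld := Real.log_nonneg hd1
  have h2 : (27 / 10 : ℝ) ≤ Real.exp 1 := by linarith [Real.exp_one_gt_d9]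
  have h3 : (12 : ℝ) ≤ Real.exp 1 ^ 3 :=
    le_trans (by norm_num) (pow_le_pow_left₀ (by norm_num) h2 3)
  have hexp : Real.exp (3 + 2 * Real.log n + L + Real.log d)
      = Real.exp 1 ^ 3 * n ^ 2 * (Real.exp 1 ^ L * d) := by
    rw [Real.exp_add, Real.exp_add, Real.exp_add, Real.exp_log (by linarith),
      show (2 : ℝ) * Real.log n = ((2 : ℕ) : ℝ) * Real.log n by norm_num, Real.exp_nat_mul,
      Real.exp_log (by linarith), ← Real.exp_nat_mul, ← Real.exp_nat_mul]
    push_cast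
    simp only [mul_one]
    ring
  have hle : ((n : ℝ) + n ^ 2 + 1) * (2 ^ L * (2 * (d + 1)))
      ≤ Real.exp 1 ^ 3 * n ^ 2 * (Real.exp 1 ^ L * d) := by
    have e1 : (n : ℝ) + n ^ 2 + 1 ≤ 3 * n ^ 2 := by nlinarith
    have e2 : (2 : ℝ) ^ L ≤ Real.exp 1 ^ L := pow_le_pow_left₀ zero_le_two (by linarith) L
    have e3 : (2 : ℝ) * (d + 1) ≤ 4 * d := by linarith
    calc ((n : ℝ) + n ^ 2 + 1) * (2 ^ L * (2 * (d + 1)))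
        ≤ 3 * n ^ 2 * (Real.exp 1 ^ L * (4 * d)) := by gcongr
      _ = 12 * n ^ 2 * (Real.exp 1 ^ L * d) := by ring
      _ ≤ _ := by gcongr
  refine hle.trans (hexp ▸ Real.exp_le_exp.2 ?_)
  nlinarith [mul_nonneg hln hld, mul_nonneg hln (sub_nonneg.2 hL1)]

/-- The deviation bound at the scale `2 ^ s`, in terms of the scale-free rate `x`. -/
lemma deviation_le_rate {n s : ℕ} (hn : 1 ≤ n) {δ M x : ℝ} (hδ : 0 < δ) (hδ1 : δ < 1)
    (hM : 1 ≤ M) (hx : 2 ^ s ≤ 2 * x) (hx1 : 1 ≤ x) :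
    Real.sqrt (Real.log (2 / δ) / n)
      + (2 * (2 * 2 ^ s * Real.sqrt (2 * n * (4 * ((1 + Real.log n) * M))) + 2 ^ s) / n
        + Real.sqrt (2 * Real.log (2 ^ (s + 2) / δ) / n))
      ≤ 40 * (1 + Real.log n) * (x * Real.sqrt M / Real.sqrt n
        + Real.sqrt (Real.log (1 / δ) / n)) := by
  have hn1 : (1 : ℝ) ≤ n := by exact_mod_cast hn
  have hn0 : (0 : ℝ) < n := by linarith
  have hln := Real.log_nonneg hn1
  set ln := 1 + Real.log n with hl
  have hln1 : 1 ≤ ln := by linarith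
  set b : ℝ := 2 ^ s with hb
  have hb1 : 1 ≤ b := one_le_pow₀ one_le_two
  set lδ := Real.log (1 / δ) with hlδ
  have hlδ0 : 0 ≤ lδ := Real.log_nonneg ((one_le_div hδ).2 hδ1.le)
  set sn := Real.sqrt n with hsn
  have hsn1 : 1 ≤ sn := Real.one_le_sqrt.2 hn1
  have hsn2 : sn * sn = n := Real.mul_self_sqrt hn0.le
  have hsM : 1 ≤ Real.sqrt M := Real.one_le_sqrt.2 hM
  set sM := Real.sqrt M with hsMdef
  set U := Real.sqrt (lδ / n) with hU
  have hU0 : 0 ≤ U := Real.sqrt_nonneg _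
  have hsub : ∀ a c : ℝ, 0 ≤ a → 0 ≤ c → Real.sqrt (a + c) ≤ Real.sqrt a + Real.sqrt c :=
    fun a c ha hc => by
      rw [Real.sqrt_le_left (by positivity), add_sq, Real.sq_sqrt ha, Real.sq_sqrt hc]
      nlinarith [mul_nonneg (Real.sqrt_nonneg a) (Real.sqrt_nonneg c)]
  have hlog2 : Real.log 2 ≤ 1 := by linarith [Real.log_two_lt_d9]
  have hlog20 : 0 ≤ Real.log 2 := Real.log_nonneg one_le_two
  have hdiv : ∀ a, Real.sqrt (a / n) = Real.sqrt a / sn := fun a => Real.sqrt_div' a hn0.le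
  have hxs : 1 / sn ≤ x * sM / sn := by
    refine div_le_div_of_nonneg_right ?_ (by linarith)
    nlinarith
  have t1 : Real.sqrt (Real.log (2 / δ) / n) ≤ U + x * sM / sn := by
    have : Real.log (2 / δ) = lδ + Real.log 2 := by
      rw [hlδ, ← Real.log_mul (by positivity) two_ne_zero]; congr 1; ring
    rw [this, add_div]
    refine (hsub _ _ (by positivity) (by positivity)).trans (add_le_add le_rfl (le_trans ?_ hxs))
    rw [hdiv]
    refine div_le_div_of_nonneg_right ?_ (by linarith)
    exact Real.sqrt_le_one.2 hlog2
  -- The constant is `28 = 2 * (2 * 3 + 1) * 2`, the last factor from `b ≤ 2 * x`.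
  have t2 : 2 * (2 * b * Real.sqrt (2 * n * (4 * (ln * M))) + b) / n
      ≤ 28 * (ln * (x * sM / sn)) := by
    have e1 : Real.sqrt (2 * n * (4 * (ln * M))) ≤ 3 * (sn * ln * sM) := by
      rw [Real.sqrt_le_left (by positivity)]
      have : (3 * (sn * ln * sM)) ^ 2 = 9 * (n * (ln ^ 2 * M)) := by
        rw [mul_pow, mul_pow, mul_pow, sq sn, hsn2, hsMdef, Real.sq_sqrt (by linarith)]
        ring
      rw [this]
      have h3 : ln * M ≤ ln ^ 2 * M := by
        have hln0 : 0 ≤ ln * M := mul_nonneg (by linarith) (by linarith)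
        nlinarith [mul_nonneg hln0 (sub_nonneg.2 hln1)]
      have h4 := mul_le_mul_of_nonneg_left h3 hn0.le
      have h5 : 0 ≤ n * (ln * M) := by positivity
      linarith
    have e2 : 1 ≤ sn * ln * sM := by
      have : 1 ≤ sn * ln := by nlinarith
      nlinarith
    rw [div_le_iff₀ hn0]
    have e3 : 28 * (ln * (x * sM / sn)) * n = 28 * x * (sn * ln * sM) := by
      rw [← hsn2]; field_simp
    rw [e3]
    have e4 : 2 * (2 * b * Real.sqrt (2 * n * (4 * (ln * M))) + b)
        ≤ 2 * (2 * b * (3 * (sn * ln * sM)) + b * (sn * ln * sM)) := by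
      have := mul_le_mul_of_nonneg_left e1 (by linarith : 0 ≤ 2 * b)
      have := mul_le_mul_of_nonneg_left e2 (by linarith : 0 ≤ b)
      linarith
    have e5 := mul_le_mul_of_nonneg_right hx (by linarith : 0 ≤ sn * ln * sM)
    linarith
  -- The price of the union over scales is linear in `s`, hence at most `2 * b`, and disappears in
  -- the main term. Over `t1`, `t2`, `t3` the main term receives `1 + 28 + 4` and `U` receives `1 +
  -- 2`, all below `40`.
  have t3 : Real.sqrt (2 * Real.log (2 ^ (s + 2) / δ) / n) ≤ 2 * U + 4 * (x * sM / sn) := by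
    have hs : ((s : ℝ) + 2) ≤ 2 * b := by
      have h := Nat.lt_two_pow_self (n := s)
      have h' : s + 1 ≤ 2 ^ s := h
      have : (s : ℝ) + 1 ≤ b := by rw [hb]; exact_mod_cast h'
      linarith
    have hlog : Real.log (2 ^ (s + 2) / δ) ≤ lδ + 2 * b := by
      have : Real.log (2 ^ (s + 2) / δ) = lδ + (s + 2) * Real.log 2 := by
        rw [hlδ, show (2 : ℝ) ^ (s + 2) / δ = 1 / δ * 2 ^ (s + 2) by ring,
          Real.log_mul (by positivity) (by positivity), Real.log_pow]
        push_cast; ring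
      rw [this]
      have : ((s : ℝ) + 2) * Real.log 2 ≤ (s + 2) * 1 :=
        mul_le_mul_of_nonneg_left hlog2 (by positivity)
      linarith
    have h1 : 2 * Real.log (2 ^ (s + 2) / δ) / n ≤ 4 * (lδ / n) + (2 * b) ^ 2 / n := by
      rw [← mul_div_assoc, ← add_div]
      refine div_le_div_of_nonneg_right ?_ hn0.le
      nlinarith
    refine (Real.sqrt_le_sqrt h1).trans ((hsub _ _ (by positivity) (by positivity)).trans
      (add_le_add (le_of_eq ?_) ?_))
    · rw [show (4 : ℝ) = 2 ^ 2 by norm_num, Real.sqrt_mul (by positivity),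
        Real.sqrt_sq zero_le_two]
    · rw [hdiv, Real.sqrt_sq (by linarith), ← mul_div_assoc]
      refine div_le_div_of_nonneg_right ?_ (by linarith)
      nlinarith
  have hX0 : 0 ≤ x * sM / sn := by positivity
  have hlX : x * sM / sn ≤ ln * (x * sM / sn) := le_mul_of_one_le_left hX0 hln1
  have hlU : U ≤ ln * U := le_mul_of_one_le_left hU0 hln1
  have e : 40 * ln * (x * sM / sn + U) = 40 * (ln * (x * sM / sn)) + 40 * (ln * U) := by ring
  rw [e]
  linarith

namespace Net

variable {d k L n : ℕ} {φ : ℝ → ℝ}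

/-- If `B` bounds the score functions by the norm of the input, then the sample margin loss equals
`1` unless `B` times the largest norm exceeds the margin. -/
lemma one_le_empLoss (hk : 2 ≤ k) (hn : 1 ≤ n) (hφ : IsActivation φ) {p : ℝ≥0∞}
    (N : Net d k L) {B γ : ℝ} (hB0 : 0 ≤ B)
    (hB : ∀ x : Fin d → ℝ, ∑ c, ∑ j, N.absProd c j * |x j| ≤ B * vecNorm p x)
    (S : Fin n → (Fin d → ℝ) × Fin k) (h : maxNorm p (inputs S) * B ≤ γ) :
    1 ≤ empLoss γ S (N.eval φ) := by
  have hn0 : (n : ℝ) ≠ 0 := by positivity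
  have h1 : ∀ i, marginLoss γ (N.eval φ) (S i) = 1 := fun i => if_pos <| by
    calc margin (N.eval φ (S i).1) (S i).2 ≤ ∑ c, |N.eval φ (S i).1 c| := margin_le_sum_abs hk _ _
      _ ≤ ∑ c, ∑ j, N.absProd c j * |(S i).1 j| :=
          Finset.sum_le_sum fun c _ => N.abs_eval_le hφ _ c
      _ ≤ B * vecNorm p (S i).1 := hB _
      _ ≤ B * maxNorm p (inputs S) := mul_le_mul_of_nonneg_left (le_maxNorm p (inputs S) i) hB0
      _ ≤ γ := by rwa [mul_comm]
  simp [empLoss, h1, hn0]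

/-- The generalization bound for all networks and margins, with any constant that bounds the
scores in terms of the input norm. -/
lemma measure_not_generalization_le (hd : 1 ≤ d) (hk : 2 ≤ k) (hL : 1 ≤ L) (hn : 1 ≤ n)
    (hφ : IsActivation φ) {p : ℝ≥0∞} (hp : 2 ≤ p) {δ : ℝ} (hδ : 0 < δ) (hδ1 : δ < 1)
    (D : Measure ((Fin d → ℝ) × Fin k)) [IsProbabilityMeasure D] :
    (Measure.pi fun _ : Fin n => D) {S | ¬ ∀ (N : Net d k L) (γ B : ℝ), 0 < γ → 0 ≤ B →
        (∀ x : Fin d → ℝ, ∑ c, ∑ j, N.absProd c j * |x j| ≤ B * vecNorm p x) →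
        popLoss D (N.eval φ) - empLoss γ S (N.eval φ) ≤ 40 * (1 + Real.log n) *
          (maxNorm p (inputs S) * B / γ * Real.sqrt (L + Real.log d) / Real.sqrt n
            + Real.sqrt (Real.log (1 / δ) / n))} ≤ ENNReal.ofReal δ := by
  have : Fact (1 ≤ p) := ⟨one_le_two.trans hp⟩
  have hn1 : (1 : ℝ) ≤ n := by exact_mod_cast hn
  have hn0 : (0 : ℝ) < n := by linarith
  have hd1 : (1 : ℝ) ≤ d := by exact_mod_cast hd
  have hL1 : (1 : ℝ) ≤ L := by exact_mod_cast hL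
  have hln := Real.log_nonneg hn1
  have hld := Real.log_nonneg hd1
  have hM : 1 ≤ (L : ℝ) + Real.log d := by linarith
  set M : ℝ := L + Real.log d
  set Λ : ℝ := 4 * ((1 + Real.log n) * M) with hΛ
  have hΛ0 : 0 < Λ := by positivity
  have hE := le_exp_of_log_bounds hd hL hn
  set t := Real.log (2 / δ) with ht
  have ht0 : 0 < t := Real.log_pos ((one_lt_div hδ).2 (by linarith))
  have hmeas : Measurable fun z : (Fin d → ℝ) × Fin k => vecNorm p z.1 :=
    (continuous_vecNorm p).measurable.comp measurable_fst
  obtain ⟨r, hr0, hr1, hr2⟩ := exists_quantile D hmeas (fun z => vecNorm_nonneg p z.1)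
    (τ := ENNReal.ofReal (t / n)) (ENNReal.ofReal_pos.2 (by positivity))
  -- A probability `a` satisfies `a ^ 2 ≤ a ≤ t / n`, which brings the tail to the order of the
  -- confidence term.
  have hr1' : D.real {z | r < vecNorm p z.1} ≤ Real.sqrt (t / n) := by
    have h1 : D.real {z | r < vecNorm p z.1} ≤ t / n :=
      ENNReal.toReal_le_of_le_ofReal (by positivity) hr1
    have h2 : D.real {z | r < vecNorm p z.1} ≤ 1 := measureReal_le_one
    have h3 : 0 ≤ D.real {z | r < vecNorm p z.1} := measureReal_nonneg
    exact Real.le_sqrt_of_sq_le (by nlinarith)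
  -- The event at scale `s` costs `δ / 2 ^ (s + 2)`, in total `δ / 2`; the other half pays for a
  -- sample whose norms all stay below `r`.
  set u : ℕ → ℝ := fun s => Real.log (2 ^ (s + 2) / δ) with hu
  have hu0 : ∀ s, 0 ≤ u s := fun s => Real.log_nonneg ((one_le_div hδ).2
    (hδ1.le.trans (one_le_pow₀ one_le_two)))
  set E : ℕ → Set (Fin n → (Fin d → ℝ) × Fin k) := fun s => {S | ∃ (N : Net d k L) (γ : ℝ),
    N.Admissible p r (2 ^ s) γ ∧ 2 * (2 * 2 ^ s * Real.sqrt (2 * n * Λ) + 2 ^ s) / n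
      + Real.sqrt (2 * u s / n)
      < ∫ z, truncLoss p r φ N γ z ∂D - (1 / (n : ℝ)) * ∑ i, truncLoss p r φ N γ (S i)} with hEdef
  set E₀ : Set (Fin n → (Fin d → ℝ) × Fin k) := {S | ∀ i, vecNorm p (S i).1 < r} with hE₀
  have hmE : ∀ s, (Measure.pi fun _ : Fin n => D) (E s)
      ≤ ENNReal.ofReal (δ / 2 / 2 / 2 ^ s) := fun s => by
    refine (measure_admissible_deviation_le hk hn hφ hp hr0 (by positivity) hΛ0 hE D
      (hu0 s)).trans (le_of_eq ?_)
    congr 1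
    rw [hu, Real.exp_neg, Real.exp_log (by positivity), inv_div, pow_add]
    field_simp
  have hmE₀ : (Measure.pi fun _ : Fin n => D) E₀ ≤ ENNReal.ofReal (δ / 2) := by
    refine (measure_pi_forall_lt_le hn D (fun z => vecNorm p z.1) ht0.le hr2).trans (le_of_eq ?_)
    rw [ht, Real.exp_neg, Real.exp_log (by positivity), inv_div]
  calc _ ≤ (Measure.pi fun _ : Fin n => D) (E₀ ∪ ⋃ s, E s) := by
        refine measure_mono fun S hS => ?_
        by_contra hgood
        simp only [Set.mem_union, Set.mem_iUnion, not_or, not_exists] at hgood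
        obtain ⟨hg0, hgs⟩ := hgood
        refine hS fun N γ B hγ hB0 hB => ?_
        set R := maxNorm p (inputs S) with hR
        have hR0 : 0 ≤ R := maxNorm_nonneg p _
        have hrR : r ≤ R := by
          simp only [hE₀, Set.mem_ofPred_eq, not_forall, not_lt] at hg0
          obtain ⟨i, hi⟩ := hg0
          exact hi.trans (le_maxNorm p (inputs S) i)
        have hlδ0 : 0 ≤ Real.log (1 / δ) := Real.log_nonneg ((one_le_div hδ).2 hδ1.le)
        rcases le_or_gt (R * B) γ with hRB | hRB
        · have h1 := N.one_le_empLoss hk hn hφ hB0 hB S hRB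
          have h2 := popLoss_le_one D (N.eval φ)
          exact le_trans (by linarith : _ ≤ (0 : ℝ)) (by positivity)
        · have hx1 : 1 ≤ R * B / γ := (one_le_div hγ).2 hRB.le
          -- The scale is chosen with the deterministic radius `r`, since the admissible class must
          -- not depend on the sample; `r ≤ R` then bounds it by the observed rate.
          obtain ⟨m, hm1, hm2⟩ := exists_nat_pow_near (x := max 1 (r * B / γ))
            (le_max_left _ _) one_lt_two
          have hmx : max 1 (r * B / γ) ≤ R * B / γ := max_le hx1 (by gcongr)
          have hadm : N.Admissible p r (2 ^ (m + 1)) γ := by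
            refine ⟨hγ, fun x hx => (hB x).trans ?_⟩
            have h1 : r * B / γ ≤ 2 ^ (m + 1) := (le_max_right _ _).trans hm2.le
            rw [div_le_iff₀ hγ] at h1
            exact (mul_le_mul_of_nonneg_left hx hB0).trans (by rwa [mul_comm])
          have hdev : ∫ z, truncLoss p r φ N γ z ∂D
              - (1 / (n : ℝ)) * ∑ i, truncLoss p r φ N γ (S i) ≤ _ :=
            not_lt.1 fun hlt => hgs (m + 1) ⟨N, γ, hadm, hlt⟩
          have hrate := deviation_le_rate (s := m + 1) hn hδ hδ1 hM
            (by rw [pow_succ]; linarith [hm1.trans hmx]) hx1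
          have hpop := N.popLoss_le_truncLoss (p := p) (r := r) hk hφ D hγ
          have hemp : (1 / (n : ℝ)) * ∑ i, truncLoss p r φ N γ (S i)
              ≤ empLoss γ S (N.eval φ) :=
            mul_le_mul_of_nonneg_left (Finset.sum_le_sum fun i _ =>
              N.truncLoss_le_marginLoss hγ (S i)) (by positivity)
          linarith
    _ ≤ (Measure.pi fun _ : Fin n => D) E₀ + ∑' s, (Measure.pi fun _ : Fin n => D) (E s) :=
        (measure_union_le _ _).trans (add_le_add le_rfl (measure_iUnion_le E))
    _ ≤ ENNReal.ofReal (δ / 2) + ∑' s : ℕ, ENNReal.ofReal (δ / 2 / 2 / 2 ^ s) :=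
        add_le_add hmE₀ (ENNReal.tsum_le_tsum hmE)
    _ = ENNReal.ofReal δ := by
        rw [← ENNReal.ofReal_tsum_of_nonneg (fun s => by positivity) (summable_geometric_two' _),
          tsum_geometric_two', ← ENNReal.ofReal_add (by positivity) (by positivity), add_halves]

end Net

end PathNorm

end

theorem mainTheorem6 :
    ∃ C : ℝ, 0 < C ∧
      ∀ (d k L n : ℕ), 1 ≤ d → 2 ≤ k → 1 ≤ L → 1 ≤ n →
      ∀ (φ : ℝ → ℝ), PathNorm.IsActivation φ →
      ∀ (q : ℝ≥0∞), 1 ≤ q → q ≤ 2 →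
      ∀ (δ : ℝ), 0 < δ → δ < 1 →
      ∀ (D : Measure ((Fin d → ℝ) × Fin k)), IsProbabilityMeasure D →
        (Measure.pi fun _ : Fin n => D)
          {S | ¬ ∀ (N : PathNorm.Net d k L) (γ : ℝ), 0 < γ →
            PathNorm.popLoss D (N.eval φ) - PathNorm.empLoss γ S (N.eval φ)
                ≤ C * (1 + Real.log n) *
                  PathNorm.rate q δ γ (PathNorm.inputs S) N
                    (PathNorm.mixedNorm q N.absProd) ∧
            PathNorm.popLoss D (N.eval φ) - PathNorm.empLoss γ S (N.eval φ)
                ≤ C * (1 + Real.log n) *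
                  PathNorm.rate q δ γ (PathNorm.inputs S) N
                    ((k : ℝ) ^ (1 - 1 / q.conjExponent.toReal) *
                      PathNorm.inducedNorm q.conjExponent N.absProd)}
          ≤ ENNReal.ofReal δ := by
  refine ⟨40, by norm_num, ?_⟩
  intro d k L n hd hk hL hn φ hφ q hq1 hq2 δ hδ hδ1 D hD
  have hp := PathNorm.two_le_conjExponent hq2
  have : Fact (1 ≤ q.conjExponent) := ⟨one_le_two.trans hp⟩
  have : Fact (1 ≤ q) := ⟨hq1⟩
  have hn1 : (1 : ℝ) ≤ n := by exact_mod_cast hn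
  have hL1 : (1 : ℝ) ≤ L := by exact_mod_cast hL
  have hln := Real.log_nonneg hn1
  refine le_trans (measure_mono (Set.compl_subset_compl.2
    fun S (hgood : ∀ (N : PathNorm.Net d k L) (γ B : ℝ), _) N γ hγ => ?_))
    (PathNorm.Net.measure_not_generalization_le hd hk hL hn hφ hp hδ hδ1 D)
  have hR0 := PathNorm.maxNorm_nonneg q.conjExponent (PathNorm.inputs S)
  have hζ := N.one_le_pathComplexity hL q (PathNorm.inputs S)
  have key : ∀ B : ℝ, 0 ≤ B → (∀ x : Fin d → ℝ, ∑ c, ∑ j, N.absProd c j * |x j|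
      ≤ B * PathNorm.vecNorm q.conjExponent x) →
      PathNorm.popLoss D (N.eval φ) - PathNorm.empLoss γ S (N.eval φ)
        ≤ 40 * (1 + Real.log n) * PathNorm.rate q δ γ (PathNorm.inputs S) N B := by
    intro B hB0 hB
    refine (hgood N γ B hγ hB0 hB).trans ?_
    refine mul_le_mul_of_nonneg_left (add_le_add ?_ le_rfl) (by positivity)
    have h0 : 0 ≤ PathNorm.maxNorm q.conjExponent (PathNorm.inputs S) * B := mul_nonneg hR0 hB0
    -- The only use of the path complexity: `ζ_q * L ≥ 1`.
    have h1 : PathNorm.maxNorm q.conjExponent (PathNorm.inputs S) * B ≤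
        PathNorm.maxNorm q.conjExponent (PathNorm.inputs S) * B *
          N.pathComplexity q (PathNorm.inputs S) * L := by
      rw [mul_assoc (PathNorm.maxNorm q.conjExponent (PathNorm.inputs S) * B)]
      exact le_mul_of_one_le_right h0 (by nlinarith)
    rw [div_mul_eq_mul_div, div_div]
    gcongr
  exact ⟨key _ (PathNorm.mixedNorm_nonneg q _) (N.sum_absProd_le_mixedNorm hq1 hq2),
    key _ (mul_nonneg (Real.rpow_nonneg (Nat.cast_nonneg k) _)
      (PathNorm.inducedNorm_nonneg _ _)) (N.sum_absProd_le_inducedNorm hq1 hq2)⟩
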